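/- Consider a Fisher market with $m\ge 1$ divisible goods and $n$ buyers, budgets $B_i>0$, and a valuation matrix $v\in\mathbb{R}_+^{n\times m}$ without zero rows or zero columns. Let $\alpha=+\infty$ (linear utilities) or $\alpha=1$ (quasi-linear utilities), and put $v_{i0}=1$, $\mu_0=\log\alpha$, $\log 0=-\infty$, $\exp(-\infty)=0$. For $\mu\in\mathbb{R}^m$ and $\delta>0$ let $$F(\mu)=\sum_{j=1}^m e^{\mu_j}+\sum_{i=1}^n B_i\max_{0\le j\le m}\{\log v_{ij}-\mu_j\},\qquad F_\delta(\mu)=\sum_{j=1}^m e^{\mu_j}+\delta\sum_{i=1}^n B_i\log\sum_{j=0}^m \exp\Big(\frac{\log v_{ij}-\mu_j}{\delta}\Big).$$ A price vector $p\in\mathbb{R}^m_{>0}$ is an $\varepsilon$-CE price vector if $\mu=(\log p_j)_j$ satisfies $F(\mu)-\inf_{\mathbb{R}^m}F\le\varepsilon$, where $\inf_{\mathbb{R}^m} F$ is finite. Let $$\underline\mu=\log\min_j\max_i\frac{v_{ij}B_i}{\|v_i\|_1+\alpha^{-1}B_i},\qquad \bar\mu=\log\Big((1-\alpha^{-1})\|B\|_1+\max_{i,j}\alpha^{-1}v_{ij}\Big).$$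 The accelerated price-adjustment method (APM) with accuracy $\varepsilon\in(0,e^{\underline\mu-1}]$ uses the parameters $\eta=1$, $\delta=\varepsilon/(2\log(m+1)\|B\|_1)$, $L=e^{\bar\mu+\eta}+\|B\|_1/\delta$, $\sigma=e^{\underline\mu-\eta}$, $q=\sigma/L$. It starts from any $y^0=\mu^0\in[\underline\mu,\bar\mu]^m$ and iterates $$\mu^{t+1}_j=\max\Big\{\underline\mu-\eta,\min\big\{y^t_j-\tfrac1L\nabla_jF_\delta(y^t),\ \bar\mu+\eta\big\}\Big\},\qquad y^{t+1}=\mu^{t+1}+\frac{1-\sqrt q}{1+\sqrt q}\,(\mu^{t+1}-\mu^t),$$ and it stops at the first $t$ with $\|\nabla F_\delta(\mu^t)\|_2\le\min\{\sigma\varepsilon,\sqrt{\sigma\varepsilon}\}$. **Theorem.** APM finds an $\varepsilon$-CE price vector in at most $\tilde{\mathcal O}(1/\sqrt\varepsilon)$ iterations. That is, there are constants $C>0$ and $d\in\mathbb{N}$, depending only on the market $(v,B,\alpha)$, such that for every $\varepsilon\in(0,e^{\underline\mu-1}]$ and every $\mu^0\in[\underline\mu,\bar\mu]^m$, APM stops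 at some iteration $T\le C\,(1+|\log\varepsilon|)^d/\sqrt\varepsilon$, and $(e^{\mu^T_j})_{j}$ is an $\varepsilon$-CE price vector. -/

import Mathlib

open scoped BigOperators

noncomputable section

/-- The two utility models: linear, `u_i(x) = ∑ j, v i j * x j`, and quasi-linear,
`u_i(x) = ∑ j, (v i j - p j) * x j`. -/
inductive UtilityKind where
  | linear
  | quasilinear

/-- `α⁻¹`, where `α = +∞` in the linear model and `α = 1` in the quasi-linear model. -/
def UtilityKind.invAlpha : UtilityKind → ℝ
  | .linear => 0
  | .quasilinear => 1

/-- The data of a Fisher market with `n` buyers and `m` divisible goods: a nonnegative valuation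
matrix without a zero row or a zero column, and positive budgets. -/
structure FisherMarket (n m : ℕ) where
  /-- `v i j` is the valuation of buyer `i` for good `j` -/
  v : Fin n → Fin m → ℝ
  /-- `B i` is the budget of buyer `i` -/
  B : Fin n → ℝ
  v_nonneg : ∀ i j, 0 ≤ v i j
  row_ne_zero : ∀ i, ∃ j, v i j ≠ 0
  col_ne_zero : ∀ j, ∃ i, v i j ≠ 0
  B_pos : ∀ i, 0 < B i

namespace FisherMarket

variable {n m : ℕ} (M : FisherMarket n m) (k : UtilityKind)

/-- `‖B‖₁`. -/
def totalBudget : ℝ := ∑ i, |M.B i|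

/-- The upper price bound `(1 - α⁻¹) ‖B‖₁ + max_{i,j} α⁻¹ v i j`. -/
def pUpper : ℝ :=
  (1 - k.invAlpha) * M.totalBudget + ⨆ i, ⨆ j, k.invAlpha * M.v i j

/-- The lower price bound `min_j max_i v i j * B i / (‖v i‖₁ + α⁻¹ B i)`. -/
def pLower : ℝ :=
  ⨅ j, ⨆ i, M.v i j * M.B i / ((∑ l, |M.v i l|) + k.invAlpha * M.B i)

/-- The upper log-price bound. -/
def muUpper : ℝ := Real.log (M.pUpper k)

/-- The lower log-price bound. -/
def muLower : ℝ := Real.log (M.pLower k)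

/-- The indices `j ∈ {0} ∪ [m]` at which `log (v i j) - μ j` is not `-∞`; the index `0`
(here `none`) has `v i 0 = 1` and `μ 0 = log α`, so it counts exactly when `α = 1`, and a good
`j` (here `some j`) counts exactly when `v i j > 0`. -/
def activeIdx (i : Fin n) : Finset (Option (Fin m)) :=
  open Classical in
  Finset.univ.filter fun o =>
    match o with
    | none => k = UtilityKind.quasilinear
    | some j => 0 < M.v i j

/-- The value `log (v i j) - μ j` at an active index; at the index `0` (active only when `α = 1`)
it is `log 1 - log 1 = 0`. -/
def logRatio (μ : EuclideanSpace ℝ (Fin m)) (i : Fin n) : Option (Fin m) → ℝ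
  | none => 0
  | some j => Real.log (M.v i j) - μ j

lemma activeIdx_nonempty (i : Fin n) : (M.activeIdx k i).Nonempty := by
  obtain ⟨j, hj⟩ := M.row_ne_zero i
  exact ⟨some j, by simpa [activeIdx] using lt_of_le_of_ne (M.v_nonneg i j) (Ne.symm hj)⟩

/-- The objective `F(μ) = ∑ j, exp (μ j) + ∑ i, B i * max_{j ∈ {0} ∪ [m]} (log (v i j) - μ j)`.
Entries equal to `-∞` do not affect the maximum. -/
def F (μ : EuclideanSpace ℝ (Fin m)) : ℝ :=
  ∑ j, Real.exp (μ j) +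
    ∑ i, M.B i * (M.activeIdx k i).sup' (M.activeIdx_nonempty k i) (M.logRatio μ i)

/-- The entropy-smoothed objective
`F_δ(μ) = ∑ j, exp (μ j) + δ * ∑ i, B i * log (∑_{j ∈ {0} ∪ [m]} exp ((log (v i j) - μ j) / δ))`.
Entries equal to `-∞` contribute `exp (-∞) = 0`. -/
def Fδ (δ : ℝ) (μ : EuclideanSpace ℝ (Fin m)) : ℝ :=
  ∑ j, Real.exp (μ j) +
    δ * ∑ i, M.B i *
      Real.log (∑ o ∈ M.activeIdx k i, Real.exp (M.logRatio μ i o / δ))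

/-- `p` is an `ε`-CE price vector: it is positive and its log-price vector `μ` satisfies
`F μ - inf F ≤ ε`, the infimum over all of `ℝ^m` being finite. -/
def IsApproxCE (ε : ℝ) (p : Fin m → ℝ) : Prop :=
  (∀ j, 0 < p j) ∧ BddBelow (Set.range (M.F k)) ∧
    M.F k (WithLp.toLp 2 fun j => Real.log (p j)) - (⨅ ν, M.F k ν) ≤ ε

/-! Parameters of the accelerated price-adjustment method (APM) at accuracy `ε`. -/

/-- The box relaxation radius. -/
def apmη : ℝ := 1

/-- The smoothing parameter. -/
def apmδ (ε : ℝ) : ℝ := ε / (2 * Real.log ((m : ℝ) + 1) * M.totalBudget)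

/-- The smoothness modulus (the stepsize is its inverse). -/
def apmL (ε : ℝ) : ℝ := Real.exp (M.muUpper k + apmη) + M.totalBudget / M.apmδ ε

/-- The strong convexity modulus. -/
def apmσ : ℝ := Real.exp (M.muLower k - apmη)

/-- The inverse condition number. -/
def apmq (ε : ℝ) : ℝ := M.apmσ k / M.apmL k ε

/-- The gradient step: a gradient step for `F_δ` of length `1 / L` from `y`, projected onto the
relaxed box. -/
def gradStep (ε : ℝ) (y : EuclideanSpace ℝ (Fin m)) : EuclideanSpace ℝ (Fin m) :=
  WithLp.toLp 2 fun j =>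
    max (M.muLower k - apmη)
      (min (y j - 1 / M.apmL k ε * gradient (M.Fδ k (M.apmδ ε)) y j) (M.muUpper k + apmη))

/-- The APM iterates: `apmIter ε μ₀ t = (μ^t, y^t)`, started at `μ^0 = y^0 = μ₀`. -/
def apmIter (ε : ℝ) (μ₀ : EuclideanSpace ℝ (Fin m)) :
    ℕ → EuclideanSpace ℝ (Fin m) × EuclideanSpace ℝ (Fin m)
  | 0 => (μ₀, μ₀)
  | t + 1 =>
    let μ := (apmIter ε μ₀ t).1
    let y := (apmIter ε μ₀ t).2
    let μ' := M.gradStep k ε y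
    (μ', μ' + ((1 - √(M.apmq k ε)) / (1 + √(M.apmq k ε))) • (μ' - μ))

/-- The stopping criterion `‖∇F_δ(μ)‖₂ ≤ min {σ ε, √(σ ε)}`. -/
def Stops (ε : ℝ) (μ : EuclideanSpace ℝ (Fin m)) : Prop :=
  ‖gradient (M.Fδ k (M.apmδ ε)) μ‖ ≤ min (M.apmσ k * ε) √(M.apmσ k * ε)

/-- APM with accuracy `ε` and starting point `μ₀` terminates after exactly `T` iterations:
`μ^T` is the first iterate that satisfies the stopping criterion. -/
def TerminatesAt (ε : ℝ) (μ₀ : EuclideanSpace ℝ (Fin m)) (T : ℕ) : Prop :=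
  IsLeast {t | M.Stops k ε (M.apmIter k ε μ₀ t).1} T

/-- The price vector `exp (μ^T)` of the `T`-th iterate. -/
def apmPrice (ε : ℝ) (μ₀ : EuclideanSpace ℝ (Fin m)) (T : ℕ) : Fin m → ℝ :=
  fun j => Real.exp ((M.apmIter k ε μ₀ T).1 j)

end FisherMarket

end

/-!
Accelerated projected gradient descent on the smoothed objective `Fδ` reaches an `ε`-minimizer of
`F` in `O(log (1 / ε) / √ε)` steps. The rate comes from the condition number `L / σ = O(1 / ε)`
of `Fδ` on the relaxed box `[μ_lower - 1, μ_upper + 1]^m`. Three points need care.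

*The query points `y^t` may leave the box*, where the moduli `L` and `σ` are no longer valid.
Upwards, a coordinate is pushed only by demand, which is at most `‖B‖₁ ≤ √q L` per unit of
steplength, so the overshoot `β v` stays below `1/2` (`FisherMarket.apmIter_invariant`). For such
`y` the descent inequality `F(x) ≤ F(p) + ⟪∇F(y), x - p⟫ + L/2 ‖x - y‖²` still holds for `x` and `p`
in the box, since strict convexity of `exp` between `p` and `y` pays for the larger curvature at
`y` (`exp_step_le`, `FisherMarket.Fδ_step_le`). Downwards there is no useful bound, and strong
convexity at `y` is not available. The Lyapunov function
`f + L / (2 (1 + s)) (‖s e + (1 - s) v‖² + s² ‖e‖²)`, with gap `f`, displacement `e` from the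
minimizer, increment `v` and `s = √q`, needs only convexity at `y`. Strong convexity enters as
quadratic growth `f ≥ σ/2 ‖e‖²` at the iterates, which do lie in the box. The function contracts by
`1 - s / 8` in each step (`lyapunov_step`).

*The unconstrained minimizer of `Fδ` lies in the box* (`FisherMarket.exists_excess_eq_zero`). At a
minimizer over the box no price is at the upper bound, since demand there falls short of the price.
Hence demand exceeds supply for no good, every buyer gets average utility per unit of money at most
`(‖v i‖₁ + α⁻¹ B i) / B i`, and the entropy bound `δ log (m + 1) < 1` shows that no good is so cheap
as to offer `e` times that.

*Stopping.* The squared gradient norm is at most `2 e L` times the gap, so the test is met after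
`O((1 + |log ε|) / √q)` steps (`FisherMarket.stops_of_le`). Conversely, at a stopping point strong
convexity bounds the gap of `Fδ` by `ε / 2`, and `F ≤ Fδ ≤ F + ε / 2`
(`FisherMarket.isApproxCE_of_stops`).

The gradient of `Fδ` is price minus softmax demand. Convexity and smoothness of the log-sum-exp part
are Jensen's inequality and Hoeffding's lemma for the softmax weights.
-/

/-! ### Second-order estimates for the exponential -/

/-- Taylor's formula of order two for `Real.exp`, with the Lagrange remainder. -/
lemma exists_exp_eq_taylor_two (x y : ℝ) :
    ∃ ξ ∈ Set.uIcc y x,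
      Real.exp x = Real.exp y + Real.exp y * (x - y) + Real.exp ξ / 2 * (x - y) ^ 2 := by
  rcases eq_or_ne y x with rfl | hne
  · exact ⟨y, Set.left_mem_uIcc, by simp⟩
  obtain ⟨ξ, hξ, h⟩ := taylor_mean_remainder_lagrange_iteratedDeriv (n := 1) hne
    (Real.contDiff_exp.contDiffOn (s := Set.uIcc y x))
  refine ⟨ξ, Set.uIoo_subset_uIcc_self hξ, ?_⟩
  have hd : derivWithin Real.exp (Set.uIcc y x) y = Real.exp y := by
    rw [(Real.differentiableAt_exp).derivWithin (uniqueDiffOn_uIcc hne y Set.left_mem_uIcc),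
      Real.deriv_exp]
  rw [taylorWithinEval_succ, taylor_within_zero_eval, iteratedDerivWithin_one, hd,
    iteratedDeriv_eq_iterate, Real.iter_deriv_exp] at h
  norm_num at h
  linarith

lemma exp_le_of_le {x y τ : ℝ} (hx : x ≤ τ) (hy : y ≤ τ) :
    Real.exp x ≤ Real.exp y + Real.exp y * (x - y) + Real.exp τ / 2 * (x - y) ^ 2 := by
  obtain ⟨ξ, hξ, h⟩ := exists_exp_eq_taylor_two x y
  have : Real.exp ξ ≤ Real.exp τ :=
    Real.exp_le_exp.2 ((Set.mem_uIcc.1 hξ).elim (fun h => h.2.trans hx) fun h => h.2.trans hy)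
  rw [h]
  gcongr

lemma le_exp_of_le {x y τ : ℝ} (hx : τ ≤ x) (hy : τ ≤ y) :
    Real.exp y + Real.exp y * (x - y) + Real.exp τ / 2 * (x - y) ^ 2 ≤ Real.exp x := by
  obtain ⟨ξ, hξ, h⟩ := exists_exp_eq_taylor_two x y
  have : Real.exp τ ≤ Real.exp ξ :=
    Real.exp_le_exp.2 ((Set.mem_uIcc.1 hξ).elim (fun h => hy.trans h.1) fun h => hx.trans h.1)
  rw [h]
  gcongr

lemma exp_tangent_le (x y : ℝ) : Real.exp y + Real.exp y * (x - y) ≤ Real.exp x := by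
  have h := Real.add_one_le_exp (x - y)
  have h2 : Real.exp x = Real.exp y * Real.exp (x - y) := by rw [← Real.exp_add]; ring_nf
  rw [h2]
  nlinarith [Real.exp_pos y]

/-- The scalar inequality behind `exp_step_le` at a query point that overshoots by `w ≤ 1/2`. -/
lemma exp_overshoot_aux {w z : ℝ} (hw0 : 0 ≤ w) (hw : w ≤ 1 / 2) (hz : 0 ≤ z) :
    Real.exp (-z) - 1 + Real.exp w * z ≤ (z + w) ^ 2 / 2 := by
  have e1 : Real.exp w ≤ 1 + w + 3 / 5 * w ^ 2 := by
    have h := Real.exp_bound' hw0 (by linarith) (n := 4) (by norm_num)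
    norm_num [Finset.sum_range_succ, Nat.factorial] at h
    have h3 : w ^ 3 ≤ 1 / 2 * w ^ 2 := by nlinarith [sq_nonneg w]
    have h4 : w ^ 4 ≤ 1 / 4 * w ^ 2 := by nlinarith [sq_nonneg w]
    linarith [sq_nonneg w]
  have hR : Real.exp (-z) ≤ 1 - z + z ^ 2 / 2 := by
    have := exp_le_of_le (x := -z) (y := 0) (τ := 0) (by linarith) le_rfl
    simp at this
    linarith
  have hwz : Real.exp w * z ≤ (1 + w + 3 / 5 * w ^ 2) * z := by gcongr
  rcases le_total z (5 / 6) with h | h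
  · nlinarith [mul_nonneg (sq_nonneg w) (sub_nonneg.2 h)]
  · have e2 : Real.exp (-z) ≤ 0.4362 := by
      have h3 : Real.exp (-z) ≤ Real.exp (-(5 / 6)) := Real.exp_le_exp.2 (by linarith)
      have h4 : (2.2926 : ℝ) ≤ Real.exp (5 / 6) := by
        have := Real.sum_le_exp_of_nonneg (x := 5 / 6) (by norm_num) 5
        norm_num [Finset.sum_range_succ, Nat.factorial] at this
        linarith
      have h5 : Real.exp (-(5 / 6)) * Real.exp (5 / 6) = 1 := by rw [← Real.exp_add]; simp
      nlinarith [Real.exp_pos (-(5 / 6))]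
    have hw2 : w ^ 2 ≤ 1 / 4 := by nlinarith
    nlinarith [mul_nonneg (sub_nonneg.2 hw2) (sub_nonneg.2 h), sq_nonneg (z - 1.15)]

/-- A descent inequality for `exp` along a step from `y` to `x`, compared with a point `p`, that
survives when the query point `y` overshoots the upper bound `τ` by at most `1/2`. The quadratic
upper bound with modulus `exp τ` fails at such `y`, but the strict convexity of `exp` between
`p` and `y` makes up for it. -/
lemma exp_step_le {p x y τ : ℝ} (hp : p ≤ τ) (hx : x ≤ τ) (hy : y ≤ τ + 1 / 2) :
    Real.exp x ≤ Real.exp p + Real.exp y * (x - p) + Real.exp τ / 2 * (x - y) ^ 2 := by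
  rcases le_total y τ with hyτ | hyτ
  · have h1 := exp_le_of_le hx hyτ
    have h2 := exp_tangent_le p y
    linarith
  rcases le_total p x with hpx | hpx
  · have h1 := exp_tangent_le p x
    have h2 : Real.exp x * (x - p) ≤ Real.exp y * (x - p) :=
      mul_le_mul_of_nonneg_right (Real.exp_le_exp.2 (hx.trans hyτ)) (sub_nonneg.2 hpx)
    have h3 : 0 ≤ Real.exp τ / 2 * (x - y) ^ 2 := by positivity
    linarith
  · -- `p ↦ exp p - exp y * p` decreases on `p ≤ y`, so the worst case is `p = τ`.
    have h1 : Real.exp τ - Real.exp p ≤ Real.exp y * (τ - p) := by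
      have h := exp_tangent_le p τ
      have h2 : Real.exp τ * (τ - p) ≤ Real.exp y * (τ - p) :=
        mul_le_mul_of_nonneg_right (Real.exp_le_exp.2 hyτ) (sub_nonneg.2 hp)
      linarith
    have h2 := exp_overshoot_aux (w := y - τ) (z := τ - x) (by linarith) (by linarith)
      (by linarith)
    have h3 : Real.exp x = Real.exp τ * Real.exp (-(τ - x)) := by rw [← Real.exp_add]; ring_nf
    have h4 : Real.exp y = Real.exp τ * Real.exp (y - τ) := by rw [← Real.exp_add]; ring_nf
    have h5 := mul_le_mul_of_nonneg_left h2 (Real.exp_pos τ).le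
    rw [show Real.exp τ * (Real.exp (-(τ - x)) - 1 + Real.exp (y - τ) * (τ - x))
      = Real.exp x - Real.exp τ + Real.exp y * (τ - x) by rw [h3, h4]; ring] at h5
    linarith [show Real.exp τ * ((τ - x + (y - τ)) ^ 2 / 2) = Real.exp τ / 2 * (x - y) ^ 2 by ring]

/-! ### Averages of exponentials -/

section Averages

variable {ι : Type*} [Fintype ι] {s θ : ι → ℝ} {M : ℝ}

lemma sum_mul_exp_pos (hs : ∀ o, 0 ≤ s o) (hs1 : ∑ o, s o = 1) :
    0 < ∑ o, s o * Real.exp (θ o) := by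
  refine lt_of_le_of_ne (Finset.sum_nonneg fun o _ => mul_nonneg (hs o) (Real.exp_pos _).le) ?_
  intro h
  have h0 := (Finset.sum_eq_zero_iff_of_nonneg
    fun o _ => mul_nonneg (hs o) (Real.exp_pos (θ o)).le).1 h.symm
  have : ∑ o, s o = 0 := Finset.sum_eq_zero fun o ho => by
    simpa [(Real.exp_pos (θ o)).ne'] using h0 o ho
  linarith

lemma sum_mul_le_log_sum_mul_exp (hs : ∀ o, 0 ≤ s o) (hs1 : ∑ o, s o = 1) :
    ∑ o, s o * θ o ≤ Real.log (∑ o, s o * Real.exp (θ o)) := by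
  rw [Real.le_log_iff_exp_le (sum_mul_exp_pos hs hs1)]
  simpa using convexOn_exp.map_sum_le (t := Finset.univ) (w := s) (p := θ)
    (fun o _ => hs o) hs1 (fun o _ => Set.mem_univ _)

/-- Hoeffding's lemma for a finitely supported distribution. -/
lemma log_sum_mul_exp_le (hs : ∀ o, 0 ≤ s o) (hs1 : ∑ o, s o = 1) (hθ : ∀ o, |θ o| ≤ M) :
    Real.log (∑ o, s o * Real.exp (θ o)) ≤ ∑ o, s o * θ o + M ^ 2 / 2 := by
  classical
  let _ : MeasurableSpace ι := ⊤
  have : DiscreteMeasurableSpace ι := ⟨fun _ => trivial⟩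
  set μ : MeasureTheory.Measure ι :=
    ∑ o, ENNReal.ofReal (s o) • MeasureTheory.Measure.dirac o with hμ
  have hint : ∀ f : ι → ℝ, ∫ x, f x ∂μ = ∑ o, s o * f o := by
    intro f
    rw [hμ, MeasureTheory.integral_finsetSum_measure
      (fun o _ => (MeasureTheory.integrable_dirac (by simp)).smul_measure (by simp))]
    simp [MeasureTheory.integral_smul_measure, ENNReal.toReal_ofReal, hs]
  have : MeasureTheory.IsProbabilityMeasure μ := by
    constructor
    rw [hμ]
    simp [MeasureTheory.Measure.finsetSum_apply]
    rw [← ENNReal.ofReal_sum_of_nonneg (fun o _ => hs o), hs1, ENNReal.ofReal_one]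
  have hH := ProbabilityTheory.hasSubgaussianMGF_of_mem_Icc (μ := μ) (X := θ) (a := -M) (b := M)
    (measurable_of_finite θ).aemeasurable (Filter.Eventually.of_forall fun o => abs_le.1 (hθ o))
  have h := hH.mgf_le 1
  obtain ⟨o₀⟩ : Nonempty ι := by
    by_contra h
    rw [not_nonempty_iff] at h
    simp at hs1
  have hM : 0 ≤ M := (abs_nonneg _).trans (hθ o₀)
  have hc : (((‖M - -M‖₊ / 2) ^ 2 : NNReal) : ℝ) = M ^ 2 := by
    push_cast
    rw [Real.norm_eq_abs, show M - -M = 2 * M by ring, abs_of_nonneg (by linarith)]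
    ring
  rw [ProbabilityTheory.mgf, hint, hint, hc] at h
  have h2 : ∑ o, s o * Real.exp (1 * (θ o - ∑ o, s o * θ o))
      = (∑ o, s o * Real.exp (θ o)) * Real.exp (-∑ o, s o * θ o) := by
    rw [Finset.sum_mul]
    refine Finset.sum_congr rfl fun o _ => ?_
    rw [mul_assoc, ← Real.exp_add]
    ring_nf
  rw [h2] at h
  rw [Real.log_le_iff_le_exp (sum_mul_exp_pos hs hs1), Real.exp_add]
  have h3 : Real.exp (∑ o, s o * θ o) * Real.exp (-∑ o, s o * θ o) = 1 := by
    rw [← Real.exp_add]; simp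
  calc _ = Real.exp (∑ o, s o * θ o) *
        ((∑ o, s o * Real.exp (θ o)) * Real.exp (-∑ o, s o * θ o)) := by
          linear_combination -(∑ o, s o * Real.exp (θ o)) * h3
    _ ≤ _ := by
      gcongr
      simpa using h

end Averages

/-! ### The Lyapunov function of the accelerated method -/

section Lyapunov

variable {E : Type*} [NormedAddCommGroup E] [InnerProductSpace ℝ E]

/-- The Lyapunov function of the accelerated gradient method: `f` is the objective gap, `e` the
displacement of the iterate from the minimizer, `v` the last increment and `s = √q`. -/
noncomputable def lyapunov (L s f : ℝ) (e v : E) : ℝ :=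
  f + L / (2 * (1 + s)) * (‖s • e + (1 - s) • v‖ ^ 2 + s ^ 2 * ‖e‖ ^ 2)

lemma lyapunov_step_sub {L s β f f' : ℝ} {e v a : E} (hL : 0 < L) (hs0 : 0 < s) (hs1 : s < 1)
    (hβ : β = (1 - s) / (1 + s))
    (h₁ : f' ≤ f + L * β * inner ℝ a v - L / 2 * ‖a‖ ^ 2)
    (h₂ : f' ≤ L * (inner ℝ a e + β * inner ℝ a v) - L / 2 * ‖a‖ ^ 2) :
    lyapunov L s f' (e + (β • v - a)) (β • v - a)
      ≤ lyapunov L s f e v - s * (f + L / 2 * β ^ 2 * ‖v‖ ^ 2) := by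
  have hβs : β * (1 + s) = 1 - s := by rw [hβ]; field_simp
  have hβ0 : 0 < β := by rw [hβ]; apply div_pos <;> linarith
  have hcomb : f' ≤ (1 - s) * f + L * (s * inner ℝ a e + β * inner ℝ a v) - L / 2 * ‖a‖ ^ 2 := by
    nlinarith [mul_le_mul_of_nonneg_left h₁ (sub_nonneg.2 hs1.le),
      mul_le_mul_of_nonneg_left h₂ hs0.le]
  have e1 : s • (e + (β • v - a)) + (1 - s) • (β • v - a) = s • e + β • v - a := by
    module
  have n1 : ‖s • e + β • v - a‖ ^ 2 = s ^ 2 * ‖e‖ ^ 2 + β ^ 2 * ‖v‖ ^ 2 + ‖a‖ ^ 2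
      + 2 * s * β * inner ℝ e v - 2 * s * inner ℝ a e - 2 * β * inner ℝ a v := by
    simp only [← real_inner_self_eq_norm_sq, inner_add_left, inner_add_right, inner_sub_left,
      inner_sub_right, real_inner_smul_left, real_inner_smul_right,
      real_inner_comm a e, real_inner_comm a v, real_inner_comm e v]
    ring
  have n2 : ‖e + (β • v - a)‖ ^ 2 = (1 - s) * ‖e‖ ^ 2 + (1 / s) * ‖s • e + β • v - a‖ ^ 2
      - (1 - s) / s * ‖β • v - a‖ ^ 2 := by
    simp only [← real_inner_self_eq_norm_sq, inner_add_left, inner_add_right, inner_sub_left,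
      inner_sub_right, real_inner_smul_left, real_inner_smul_right,
      real_inner_comm a e, real_inner_comm a v, real_inner_comm e v]
    field_simp
    ring
  have n3 : ‖s • e + (1 - s) • v‖ ^ 2 = s ^ 2 * ‖e‖ ^ 2 + (1 - s) ^ 2 * ‖v‖ ^ 2
      + 2 * s * (1 - s) * inner ℝ e v := by
    simp only [← real_inner_self_eq_norm_sq, inner_add_left, inner_add_right,
      real_inner_smul_left, real_inner_smul_right, real_inner_comm e v]
    ring
  have b1 : s ^ 2 * ‖e + (β • v - a)‖ ^ 2
      ≤ s ^ 2 * (1 - s) * ‖e‖ ^ 2 + s * ‖s • e + β • v - a‖ ^ 2 := by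
    rw [n2]
    have : 0 ≤ s * (1 - s) * ‖β • v - a‖ ^ 2 := by
      have := sub_nonneg.2 hs1.le
      positivity
    have e : s ^ 2 * ((1 - s) * ‖e‖ ^ 2 + 1 / s * ‖s • e + β • v - a‖ ^ 2
        - (1 - s) / s * ‖β • v - a‖ ^ 2) = s ^ 2 * (1 - s) * ‖e‖ ^ 2
        + s * ‖s • e + β • v - a‖ ^ 2 - s * (1 - s) * ‖β • v - a‖ ^ 2 := by
      field_simp
    linarith
  unfold lyapunov
  rw [e1]
  have c0 : 0 < L / (2 * (1 + s)) := by positivity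
  have b2 : L / (2 * (1 + s)) * (‖s • e + β • v - a‖ ^ 2 + s ^ 2 * ‖e + (β • v - a)‖ ^ 2)
      ≤ L / (2 * (1 + s)) * ((1 + s) * ‖s • e + β • v - a‖ ^ 2 + s ^ 2 * (1 - s) * ‖e‖ ^ 2) := by
    exact mul_le_mul_of_nonneg_left (by linarith) c0.le
  have b3 : L / (2 * (1 + s)) *
        ((1 + s) * ‖s • e + β • v - a‖ ^ 2 + s ^ 2 * (1 - s) * ‖e‖ ^ 2)
      = L / 2 * β ^ 2 * ‖v‖ ^ 2 + L / 2 * ‖a‖ ^ 2 - L * (s * inner ℝ a e + β * inner ℝ a v)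
        + L * s * β * inner ℝ e v + L / (1 + s) * s ^ 2 * ‖e‖ ^ 2 := by
    rw [n1]
    field_simp
    ring
  have b4 : L / (2 * (1 + s)) * (‖s • e + (1 - s) • v‖ ^ 2 + s ^ 2 * ‖e‖ ^ 2)
      = L / (1 + s) * s ^ 2 * ‖e‖ ^ 2 + L / 2 * (1 + s) * β ^ 2 * ‖v‖ ^ 2
        + L * s * β * inner ℝ e v := by
    rw [n3, ← hβs]
    field_simp
    ring
  rw [b4]
  rw [b3] at b2
  nlinarith [b2, hcomb]

lemma lyapunov_le {L s β f : ℝ} {e v : E} (hL : 0 < L) (hs0 : 0 < s) (hs1 : s < 1)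
    (hβ : β = (1 - s) / (1 + s)) (hg : L * s ^ 2 / 2 * ‖e‖ ^ 2 ≤ f) :
    lyapunov L s f e v ≤ 8 * (f + L / 2 * β ^ 2 * ‖v‖ ^ 2) := by
  have hβs : β * (1 + s) = 1 - s := by rw [hβ]; field_simp
  have hβ0 : 0 < β := by rw [hβ]; apply div_pos <;> linarith
  have n : ‖s • e + (1 - s) • v‖ ^ 2 ≤ 2 * (s ^ 2 * ‖e‖ ^ 2) + 2 * ((1 - s) ^ 2 * ‖v‖ ^ 2) := by
    have h := norm_add_le (s • e) ((1 - s) • v)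
    rw [norm_smul, norm_smul, Real.norm_of_nonneg hs0.le,
      Real.norm_of_nonneg (sub_nonneg.2 hs1.le)] at h
    nlinarith [norm_nonneg (s • e + (1 - s) • v), sq_nonneg (s * ‖e‖ - (1 - s) * ‖v‖)]
  have hsβ : (1 - s) ^ 2 ≤ 4 * β ^ 2 := by
    rw [← hβs]
    nlinarith [mul_pos hβ0 hβ0, mul_pos hs0 (mul_pos hβ0 hβ0)]
  have hc : L / (2 * (1 + s)) ≤ L / 2 := by
    apply div_le_div_of_nonneg_left hL.le <;> linarith
  have h2 : ‖s • e + (1 - s) • v‖ ^ 2 + s ^ 2 * ‖e‖ ^ 2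
      ≤ 3 * (s ^ 2 * ‖e‖ ^ 2) + 8 * β ^ 2 * ‖v‖ ^ 2 := by
    nlinarith [mul_le_mul_of_nonneg_right hsβ (sq_nonneg ‖v‖)]
  have h3 : L / (2 * (1 + s)) * (‖s • e + (1 - s) • v‖ ^ 2 + s ^ 2 * ‖e‖ ^ 2)
      ≤ L / 2 * (3 * (s ^ 2 * ‖e‖ ^ 2) + 8 * β ^ 2 * ‖v‖ ^ 2) := by
    apply mul_le_mul hc h2 (by positivity) (by positivity)
  unfold lyapunov
  have : 0 ≤ L * s ^ 2 / 2 * ‖e‖ ^ 2 := by positivity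
  nlinarith

/-- One accelerated step with step vector `a` contracts the Lyapunov function by `1 - s / 8`.
The hypotheses `h₁` and `h₂` are the descent inequality compared with the current iterate and with
the minimizer. The extra term `s ^ 2 * ‖e‖ ^ 2` in the Lyapunov function makes plain convexity at
the query point sufficient: strong convexity enters only through the quadratic growth `hg`. -/
lemma lyapunov_step {L s β f f' : ℝ} {e v a : E} (hL : 0 < L) (hs0 : 0 < s) (hs1 : s < 1)
    (hβ : β = (1 - s) / (1 + s))
    (h₁ : f' ≤ f + L * β * inner ℝ a v - L / 2 * ‖a‖ ^ 2)
    (h₂ : f' ≤ L * (inner ℝ a e + β * inner ℝ a v) - L / 2 * ‖a‖ ^ 2)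
    (hg : L * s ^ 2 / 2 * ‖e‖ ^ 2 ≤ f) :
    lyapunov L s f' (e + (β • v - a)) (β • v - a) ≤ (1 - s / 8) * lyapunov L s f e v := by
  have key := lyapunov_step_sub hL hs0 hs1 hβ h₁ h₂
  have upper := lyapunov_le (v := v) hL hs0 hs1 hβ hg
  nlinarith

end Lyapunov

lemma EuclideanSpace.inner_eq_sum_mul {m : ℕ} (x y : EuclideanSpace ℝ (Fin m)) :
    inner ℝ x y = ∑ j, x j * y j := by
  simp [PiLp.inner_apply, mul_comm]

namespace FisherMarket

/-! ### The smoothed objective and its gradient -/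

section Smoothing

variable {n m : ℕ} (M : FisherMarket n m) (k : UtilityKind) (δ : ℝ)

lemma totalBudget_eq : M.totalBudget = ∑ i, M.B i := by
  simp [totalBudget, abs_of_pos (M.B_pos _)]

/-- The share of the budget of buyer `i` that goes to option `o` in the smoothed model, where
`none` stands for keeping the money: the softmax weights of `(log (v i o) - μ o) / δ`, with weight
zero at inactive options. -/
noncomputable def share (μ : EuclideanSpace ℝ (Fin m)) (i : Fin n) (o : Option (Fin m)) : ℝ :=
  open Classical in
  if o ∈ M.activeIdx k i then
    Real.exp (M.logRatio μ i o / δ) / ∑ o' ∈ M.activeIdx k i, Real.exp (M.logRatio μ i o' / δ)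
  else 0

/-- The smoothed demand for good `j`, in units of money. -/
noncomputable def demand (μ : EuclideanSpace ℝ (Fin m)) (j : Fin m) : ℝ :=
  ∑ i, M.B i * M.share k δ μ i (some j)

/-- The gradient of `Fδ`: price minus demand. -/
noncomputable def excess (μ : EuclideanSpace ℝ (Fin m)) : EuclideanSpace ℝ (Fin m) :=
  WithLp.toLp 2 fun j => Real.exp (μ j) - M.demand k δ μ j

/-- The log-sum-exp value of buyer `i`. -/
noncomputable def lse (μ : EuclideanSpace ℝ (Fin m)) (i : Fin n) : ℝ :=
  Real.log (∑ o ∈ M.activeIdx k i, Real.exp (M.logRatio μ i o / δ))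

lemma sum_exp_pos (μ : EuclideanSpace ℝ (Fin m)) (i : Fin n) :
    0 < ∑ o ∈ M.activeIdx k i, Real.exp (M.logRatio μ i o / δ) :=
  Finset.sum_pos (fun _ _ => Real.exp_pos _) (M.activeIdx_nonempty k i)

lemma share_nonneg (μ : EuclideanSpace ℝ (Fin m)) (i : Fin n) (o : Option (Fin m)) :
    0 ≤ M.share k δ μ i o := by
  unfold share
  split_ifs
  · exact div_nonneg (Real.exp_pos _).le (M.sum_exp_pos k δ μ i).le
  · exact le_rfl

lemma sum_share_mul (μ : EuclideanSpace ℝ (Fin m)) (i : Fin n) (f : Option (Fin m) → ℝ) :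
    ∑ o, M.share k δ μ i o * f o =
      (∑ o ∈ M.activeIdx k i, Real.exp (M.logRatio μ i o / δ) * f o) /
        ∑ o ∈ M.activeIdx k i, Real.exp (M.logRatio μ i o / δ) := by
  classical
  rw [Finset.sum_div, ← Finset.sum_subset (Finset.subset_univ (M.activeIdx k i))]
  · refine Finset.sum_congr rfl fun o ho => ?_
    rw [share, if_pos ho]
    ring
  · intro o _ ho
    rw [share, if_neg ho, zero_mul]

lemma sum_share (μ : EuclideanSpace ℝ (Fin m)) (i : Fin n) : ∑ o, M.share k δ μ i o = 1 := by
  have h := M.sum_share_mul k δ μ i fun _ => 1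
  simp only [mul_one] at h
  rw [h, div_self (M.sum_exp_pos k δ μ i).ne']

lemma share_le_one (μ : EuclideanSpace ℝ (Fin m)) (i : Fin n) (o : Option (Fin m)) :
    M.share k δ μ i o ≤ 1 := by
  rw [← M.sum_share k δ μ i]
  exact Finset.single_le_sum (f := M.share k δ μ i) (fun o _ => M.share_nonneg k δ μ i o)
    (Finset.mem_univ o)

lemma demand_le_totalBudget (μ : EuclideanSpace ℝ (Fin m)) (j : Fin m) :
    M.demand k δ μ j ≤ M.totalBudget := by
  rw [totalBudget_eq]
  exact Finset.sum_le_sum fun i _ =>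
    mul_le_of_le_one_right (M.B_pos i).le (M.share_le_one k δ μ i _)

lemma neg_totalBudget_le_excess (μ : EuclideanSpace ℝ (Fin m)) (j : Fin m) :
    -M.totalBudget ≤ M.excess k δ μ j := by
  have h1 := M.demand_le_totalBudget k δ μ j
  have h2 := Real.exp_pos (μ j)
  simp only [excess]
  linarith

lemma lse_eq_add (x y : EuclideanSpace ℝ (Fin m)) (i : Fin n) :
    M.lse k δ x i = M.lse k δ y i + Real.log (∑ o, M.share k δ y i o *
      Real.exp ((M.logRatio x i o - M.logRatio y i o) / δ)) := by
  rw [sum_share_mul, lse, lse, ← Real.log_mul (M.sum_exp_pos k δ y i).ne', mul_div_cancel₀]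
  · congr 1
    refine Finset.sum_congr rfl fun o _ => ?_
    rw [← Real.exp_add]
    ring_nf
  · exact (M.sum_exp_pos k δ y i).ne'
  · refine (div_pos ?_ (M.sum_exp_pos k δ y i)).ne'
    exact Finset.sum_pos (fun o _ => mul_pos (Real.exp_pos _) (Real.exp_pos _))
      (M.activeIdx_nonempty k i)

lemma sum_share_mul_sub (x y : EuclideanSpace ℝ (Fin m)) (i : Fin n) :
    ∑ o, M.share k δ y i o * ((M.logRatio x i o - M.logRatio y i o) / δ) =
      -(∑ j, M.share k δ y i (some j) * (x j - y j)) / δ := by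
  rw [Fintype.sum_option, ← Finset.sum_neg_distrib, Finset.sum_div]
  simp only [logRatio, sub_self, zero_div, mul_zero, zero_add]
  refine Finset.sum_congr rfl fun j _ => ?_
  ring

lemma lse_ge (x y : EuclideanSpace ℝ (Fin m)) (i : Fin n) :
    M.lse k δ y i - (∑ j, M.share k δ y i (some j) * (x j - y j)) / δ ≤ M.lse k δ x i := by
  rw [M.lse_eq_add k δ x y i]
  have h := sum_mul_le_log_sum_mul_exp (θ := fun o => (M.logRatio x i o - M.logRatio y i o) / δ)
    (M.share_nonneg k δ y i) (M.sum_share k δ y i)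
  rw [sum_share_mul_sub, neg_div] at h
  linarith

lemma lse_le (x y : EuclideanSpace ℝ (Fin m)) (i : Fin n) :
    M.lse k δ x i ≤ M.lse k δ y i - (∑ j, M.share k δ y i (some j) * (x j - y j)) / δ +
      ‖x - y‖ ^ 2 / δ ^ 2 / 2 := by
  rw [M.lse_eq_add k δ x y i]
  have h := log_sum_mul_exp_le (θ := fun o => (M.logRatio x i o - M.logRatio y i o) / δ)
    (M := ‖x - y‖ / |δ|) (M.share_nonneg k δ y i) (M.sum_share k δ y i) (by
      intro o
      rw [abs_div]
      gcongr
      cases o with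
      | none => simp [logRatio]
      | some j =>
        have h := PiLp.norm_apply_le (x - y) j
        rw [Real.norm_eq_abs, ← abs_neg] at h
        refine (le_of_eq ?_).trans h
        congr 1
        simp [logRatio])
  rw [sum_share_mul_sub, neg_div, div_pow, sq_abs] at h
  linarith

lemma Fδ_eq (μ : EuclideanSpace ℝ (Fin m)) :
    M.Fδ k δ μ = ∑ j, Real.exp (μ j) + ∑ i, M.B i * (δ * M.lse k δ μ i) := by
  unfold Fδ lse
  rw [Finset.mul_sum]
  congr 1
  exact Finset.sum_congr rfl fun i _ => by ring

variable {δ}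

lemma sum_demand_mul (y d : EuclideanSpace ℝ (Fin m)) :
    ∑ j, M.demand k δ y j * d j = ∑ i, M.B i * ∑ j, M.share k δ y i (some j) * d j := by
  simp only [demand, Finset.sum_mul, Finset.mul_sum]
  rw [Finset.sum_comm]
  exact Finset.sum_congr rfl fun i _ => Finset.sum_congr rfl fun j _ => by ring

lemma sum_lse_ge (hδ : 0 < δ) (x y : EuclideanSpace ℝ (Fin m)) :
    ∑ i, M.B i * (δ * M.lse k δ y i) - ∑ j, M.demand k δ y j * (x - y) j ≤
      ∑ i, M.B i * (δ * M.lse k δ x i) := by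
  rw [sum_demand_mul, ← Finset.sum_sub_distrib]
  refine Finset.sum_le_sum fun i _ => ?_
  rw [← mul_sub]
  refine mul_le_mul_of_nonneg_left ?_ (M.B_pos i).le
  have h := mul_le_mul_of_nonneg_left (M.lse_ge k δ x y i) hδ.le
  rw [mul_sub, mul_div_cancel₀ _ hδ.ne'] at h
  simpa using h

lemma sum_lse_le (hδ : 0 < δ) (x y : EuclideanSpace ℝ (Fin m)) :
    ∑ i, M.B i * (δ * M.lse k δ x i) ≤
      ∑ i, M.B i * (δ * M.lse k δ y i) - ∑ j, M.demand k δ y j * (x - y) j +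
        M.totalBudget / δ / 2 * ‖x - y‖ ^ 2 := by
  rw [sum_demand_mul, ← Finset.sum_sub_distrib, totalBudget_eq, Finset.sum_div, Finset.sum_div,
    Finset.sum_mul, ← Finset.sum_add_distrib]
  refine Finset.sum_le_sum fun i _ => ?_
  have h := mul_le_mul_of_nonneg_left (M.lse_le k δ x y i) (mul_pos (M.B_pos i) hδ).le
  simp only [PiLp.sub_apply]
  calc _ = M.B i * δ * M.lse k δ x i := by ring
    _ ≤ _ := h
    _ = _ := by field_simp

/-- The descent inequality along a step from the query point `y` to `x`, compared with `p`. The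
query point may exceed the upper bound `τ` on `x` and `p` by up to `1/2`. -/
lemma Fδ_step_le (hδ : 0 < δ) {τ : ℝ} {p x y : EuclideanSpace ℝ (Fin m)} (hp : ∀ j, p j ≤ τ)
    (hx : ∀ j, x j ≤ τ) (hy : ∀ j, y j ≤ τ + 1 / 2) :
    M.Fδ k δ x ≤ M.Fδ k δ p + inner ℝ (M.excess k δ y) (x - p) +
      (Real.exp τ + M.totalBudget / δ) / 2 * ‖x - y‖ ^ 2 := by
  have h1 := M.sum_lse_le k hδ x y
  have h2 := M.sum_lse_ge k hδ p y
  have h3 : ∑ j, Real.exp (x j) ≤ ∑ j, (Real.exp (p j) + Real.exp (y j) * (x - p) j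
      + Real.exp τ / 2 * (x - y) j ^ 2) :=
    Finset.sum_le_sum fun j _ => exp_step_le (hp j) (hx j) (hy j)
  rw [Finset.sum_add_distrib, Finset.sum_add_distrib, ← Finset.mul_sum,
    ← EuclideanSpace.real_norm_sq_eq] at h3
  have h4 : inner ℝ (M.excess k δ y) (x - p) = ∑ j, Real.exp (y j) * (x - p) j -
      (∑ j, M.demand k δ y j * (x - y) j - ∑ j, M.demand k δ y j * (p - y) j) := by
    rw [EuclideanSpace.inner_eq_sum_mul, ← Finset.sum_sub_distrib, ← Finset.sum_sub_distrib]
    refine Finset.sum_congr rfl fun j _ => ?_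
    simp only [excess, PiLp.sub_apply]
    ring
  rw [Fδ_eq, Fδ_eq, h4]
  linarith

lemma Fδ_le (hδ : 0 < δ) {τ : ℝ} {x y : EuclideanSpace ℝ (Fin m)}
    (hx : ∀ j, x j ≤ τ) (hy : ∀ j, y j ≤ τ) :
    M.Fδ k δ x ≤ M.Fδ k δ y + inner ℝ (M.excess k δ y) (x - y) +
      (Real.exp τ + M.totalBudget / δ) / 2 * ‖x - y‖ ^ 2 :=
  M.Fδ_step_le k hδ hy hx fun j => (hy j).trans (by linarith)

/-- `Fδ` is strongly convex with modulus `exp τ` on `{μ | ∀ j, τ ≤ μ j}`. -/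
lemma Fδ_ge (hδ : 0 < δ) {τ : ℝ} {x y : EuclideanSpace ℝ (Fin m)}
    (hx : ∀ j, τ ≤ x j) (hy : ∀ j, τ ≤ y j) :
    M.Fδ k δ y + inner ℝ (M.excess k δ y) (x - y) + Real.exp τ / 2 * ‖x - y‖ ^ 2 ≤
      M.Fδ k δ x := by
  have h2 := M.sum_lse_ge k hδ x y
  have h3 : ∑ j, (Real.exp (y j) + Real.exp (y j) * (x - y) j
      + Real.exp τ / 2 * (x - y) j ^ 2) ≤ ∑ j, Real.exp (x j) :=
    Finset.sum_le_sum fun j _ => le_exp_of_le (hx j) (hy j)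
  rw [Finset.sum_add_distrib, Finset.sum_add_distrib, ← Finset.mul_sum,
    ← EuclideanSpace.real_norm_sq_eq] at h3
  have h4 : inner ℝ (M.excess k δ y) (x - y) = ∑ j, Real.exp (y j) * (x - y) j -
      ∑ j, M.demand k δ y j * (x - y) j := by
    rw [EuclideanSpace.inner_eq_sum_mul, ← Finset.sum_sub_distrib]
    refine Finset.sum_congr rfl fun j _ => ?_
    simp only [excess, PiLp.sub_apply]
    ring
  rw [Fδ_eq, Fδ_eq, h4]
  linarith

lemma Fδ_tangent_le (hδ : 0 < δ) (x y : EuclideanSpace ℝ (Fin m)) :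
    M.Fδ k δ y + inner ℝ (M.excess k δ y) (x - y) ≤ M.Fδ k δ x := by
  have hn : ∀ (z : EuclideanSpace ℝ (Fin m)) j, -‖z‖ ≤ z j := fun z j =>
    (abs_le.1 (PiLp.norm_apply_le z j)).1
  have h := M.Fδ_ge k hδ (τ := -‖x‖ - ‖y‖) (x := x) (y := y)
    (fun j => by linarith [hn x j, norm_nonneg y]) (fun j => by linarith [hn y j, norm_nonneg x])
  have : 0 ≤ Real.exp (-‖x‖ - ‖y‖) / 2 * ‖x - y‖ ^ 2 := by positivity
  linarith

/-- The two-sided quadratic bounds identify the gradient without differentiating. -/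
lemma hasGradientAt_Fδ (hδ : 0 < δ) (y : EuclideanSpace ℝ (Fin m)) :
    HasGradientAt (M.Fδ k δ) (M.excess k δ y) y := by
  have hn : ∀ (z : EuclideanSpace ℝ (Fin m)) j, z j ≤ ‖z‖ := fun z j =>
    (abs_le.1 (PiLp.norm_apply_le z j)).2
  rw [hasGradientAt_iff_isLittleO]
  have hO : (fun x => M.Fδ k δ x - M.Fδ k δ y - inner ℝ (M.excess k δ y) (x - y)) =O[nhds y]
      fun x => ‖x - y‖ ^ 2 := by
    refine Asymptotics.IsBigO.of_bound ((Real.exp (‖y‖ + 1) + M.totalBudget / δ) / 2) ?_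
    filter_upwards [Metric.ball_mem_nhds y one_pos] with x hx
    rw [mem_ball_iff_norm] at hx
    have hxy : ‖x‖ ≤ ‖y‖ + 1 := by
      have := norm_le_norm_add_norm_sub' x y
      linarith
    have h1 := M.Fδ_tangent_le k hδ x y
    have h2 := M.Fδ_le k hδ (τ := ‖y‖ + 1) (x := x) (y := y)
      (fun j => (hn x j).trans hxy) (fun j => by linarith [hn y j])
    rw [Real.norm_of_nonneg (by linarith), Real.norm_of_nonneg (by positivity)]
    linarith
  refine hO.trans_isLittleO ?_
  rw [← Asymptotics.isLittleO_norm_right]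
  have : (fun x : EuclideanSpace ℝ (Fin m) => ‖x - y‖ ^ 2) =
      (fun t : ℝ => t ^ 2) ∘ fun x => ‖x - y‖ := rfl
  rw [this]
  refine ((Asymptotics.isLittleO_pow_id one_lt_two).comp_tendsto
    (k := fun x : EuclideanSpace ℝ (Fin m) => ‖x - y‖) ?_)
  have : Continuous fun x : EuclideanSpace ℝ (Fin m) => ‖x - y‖ := by fun_prop
  simpa using this.tendsto y

lemma gradient_Fδ (hδ : 0 < δ) (y : EuclideanSpace ℝ (Fin m)) :
    gradient (M.Fδ k δ) y = M.excess k δ y :=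
  (M.hasGradientAt_Fδ k hδ y).gradient

lemma continuous_Fδ (hδ : 0 < δ) : Continuous (M.Fδ k δ) :=
  continuous_iff_continuousAt.2 fun y => (M.hasGradientAt_Fδ k hδ y).continuousAt

/-- Smoothing increases the objective. -/
lemma F_le_Fδ (hδ : 0 < δ) (μ : EuclideanSpace ℝ (Fin m)) : M.F k μ ≤ M.Fδ k δ μ := by
  rw [Fδ_eq, F]
  gcongr with i _
  · exact (M.B_pos i).le
  refine Finset.sup'_le _ _ fun o ho => ?_
  have h : M.logRatio μ i o / δ ≤ M.lse k δ μ i := by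
    rw [lse, Real.le_log_iff_exp_le (M.sum_exp_pos k δ μ i)]
    exact Finset.single_le_sum (f := fun o => Real.exp (M.logRatio μ i o / δ))
      (fun _ _ => (Real.exp_pos _).le) ho
  rw [div_le_iff₀ hδ] at h
  linarith

lemma card_activeIdx_le (i : Fin n) : ((M.activeIdx k i).card : ℝ) ≤ (m : ℝ) + 1 := by
  have h := Finset.card_le_univ (M.activeIdx k i)
  rw [Fintype.card_option, Fintype.card_fin] at h
  exact_mod_cast h

/-- Smoothing increases the objective by at most `δ ‖B‖₁ log (m + 1)`. -/
lemma Fδ_le_F_add (hδ : 0 < δ) (μ : EuclideanSpace ℝ (Fin m)) :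
    M.Fδ k δ μ ≤ M.F k μ + δ * Real.log ((m : ℝ) + 1) * M.totalBudget := by
  rw [Fδ_eq, F, totalBudget_eq, add_assoc, Finset.mul_sum, ← Finset.sum_add_distrib]
  gcongr with i _
  have hB := M.B_pos i
  set S := (M.activeIdx k i).sup' (M.activeIdx_nonempty k i) (M.logRatio μ i)
  have h : M.lse k δ μ i ≤ Real.log ((m : ℝ) + 1) + S / δ := by
    rw [lse, Real.log_le_iff_le_exp (M.sum_exp_pos k δ μ i), Real.exp_add,
      Real.exp_log (by positivity)]
    calc _ ≤ ∑ o ∈ M.activeIdx k i, Real.exp (S / δ) := by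
          gcongr with o ho
          exact Finset.le_sup' (M.logRatio μ i) ho
      _ = ((M.activeIdx k i).card : ℝ) * Real.exp (S / δ) := by simp
      _ ≤ _ := by gcongr; exact M.card_activeIdx_le k i
  have h2 := mul_le_mul_of_nonneg_left h hδ.le
  rw [mul_add, mul_div_cancel₀ _ hδ.ne'] at h2
  nlinarith

end Smoothing

end FisherMarket

namespace FisherMarket

/-! ### Price bounds and parameters -/

section Bounds

variable {n m : ℕ} (M : FisherMarket n m) (k : UtilityKind)

lemma invAlpha_nonneg : 0 ≤ k.invAlpha := by cases k <;> simp [UtilityKind.invAlpha]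

/-- The denominator `‖v i‖₁ + α⁻¹ B i` in the lower price bound. -/
noncomputable def wealth (i : Fin n) : ℝ := (∑ l, |M.v i l|) + k.invAlpha * M.B i

lemma v_le_sum (i : Fin n) (j : Fin m) : M.v i j ≤ ∑ l, |M.v i l| :=
  (le_abs_self _).trans
    (Finset.single_le_sum (f := fun l => |M.v i l|) (fun _ _ => abs_nonneg _) (Finset.mem_univ j))

lemma sum_abs_v_pos (i : Fin n) : 0 < ∑ l, |M.v i l| := by
  obtain ⟨j, hj⟩ := M.row_ne_zero i
  exact (lt_of_le_of_ne (M.v_nonneg i j) hj.symm).trans_le (M.v_le_sum i j)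

lemma sum_abs_v_le_wealth (i : Fin n) : ∑ l, |M.v i l| ≤ M.wealth k i :=
  le_add_of_nonneg_right (mul_nonneg (invAlpha_nonneg k) (M.B_pos i).le)

lemma wealth_pos (i : Fin n) : 0 < M.wealth k i :=
  (M.sum_abs_v_pos i).trans_le (M.sum_abs_v_le_wealth k i)

lemma exists_pLower_le (j : Fin m) : ∃ i, M.pLower k ≤ M.v i j * M.B i / M.wealth k i := by
  obtain ⟨i₀, _⟩ := M.col_ne_zero j
  have : Nonempty (Fin n) := ⟨i₀⟩
  obtain ⟨i, hi⟩ := exists_eq_ciSup_of_finite (f := fun i => M.v i j * M.B i / M.wealth k i)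
  refine ⟨i, ?_⟩
  rw [hi]
  exact ciInf_le (f := fun j => ⨆ i, M.v i j * M.B i / M.wealth k i)
    (Set.finite_range _).bddBelow j

lemma pLower_pos (hm : 0 < m) : 0 < M.pLower k := by
  have : Nonempty (Fin m) := ⟨⟨0, hm⟩⟩
  obtain ⟨j, hj⟩ := exists_eq_ciInf_of_finite (f := fun j => ⨆ i, M.v i j * M.B i / M.wealth k i)
  obtain ⟨i, hi⟩ := M.col_ne_zero j
  have hv : 0 < M.v i j := lt_of_le_of_ne (M.v_nonneg i j) hi.symm
  change 0 < ⨅ j, ⨆ i, M.v i j * M.B i / M.wealth k i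
  rw [← hj]
  exact (div_pos (mul_pos hv (M.B_pos i)) (M.wealth_pos k i)).trans_le
    (le_ciSup (f := fun i => M.v i j * M.B i / M.wealth k i) (Set.finite_range _).bddAbove i)

lemma B_le_totalBudget (i : Fin n) : M.B i ≤ M.totalBudget := by
  rw [totalBudget_eq]
  exact Finset.single_le_sum (f := M.B) (fun i _ => (M.B_pos i).le) (Finset.mem_univ i)

lemma pLower_le_totalBudget (hm : 0 < m) : M.pLower k ≤ M.totalBudget := by
  obtain ⟨i, hi⟩ := M.exists_pLower_le k ⟨0, hm⟩
  refine hi.trans (le_trans ?_ (M.B_le_totalBudget i))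
  rw [div_le_iff₀ (M.wealth_pos k i), mul_comm]
  exact mul_le_mul_of_nonneg_left ((M.v_le_sum i _).trans (M.sum_abs_v_le_wealth k i))
    (M.B_pos i).le

lemma totalBudget_pos (hm : 0 < m) : 0 < M.totalBudget :=
  (M.pLower_pos .linear hm).trans_le (M.pLower_le_totalBudget .linear hm)

lemma pUpper_linear : M.pUpper .linear = M.totalBudget := by
  simp [pUpper, UtilityKind.invAlpha]

lemma v_le_pUpper (i : Fin n) (j : Fin m) : M.v i j ≤ M.pUpper .quasilinear := by
  have h1 := le_ciSup (f := fun j => M.v i j) (Set.finite_range _).bddAbove j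
  have h2 := le_ciSup (f := fun i => ⨆ j, M.v i j) (Set.finite_range _).bddAbove i
  simpa [pUpper, UtilityKind.invAlpha] using h1.trans h2

lemma pLower_le_pUpper (hm : 0 < m) : M.pLower k ≤ M.pUpper k := by
  cases k with
  | linear => rw [pUpper_linear]; exact M.pLower_le_totalBudget _ hm
  | quasilinear =>
    obtain ⟨i, hi⟩ := M.exists_pLower_le .quasilinear ⟨0, hm⟩
    refine hi.trans (le_trans ?_ (M.v_le_pUpper i ⟨0, hm⟩))
    rw [div_le_iff₀ (M.wealth_pos _ i)]
    refine mul_le_mul_of_nonneg_left ?_ (M.v_nonneg i _)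
    have := M.sum_abs_v_pos i
    simp only [wealth, UtilityKind.invAlpha]
    linarith

lemma pUpper_pos (hm : 0 < m) : 0 < M.pUpper k :=
  (M.pLower_pos k hm).trans_le (M.pLower_le_pUpper k hm)

lemma muLower_le_muUpper (hm : 0 < m) : M.muLower k ≤ M.muUpper k :=
  Real.log_le_log (M.pLower_pos k hm) (M.pLower_le_pUpper k hm)

lemma one_le_two_mul_log (hm : 0 < m) : 1 ≤ 2 * Real.log ((m : ℝ) + 1) := by
  have h1 : (1 : ℝ) ≤ m := by exact_mod_cast hm
  have h2 : Real.log 2 ≤ Real.log ((m : ℝ) + 1) := Real.log_le_log (by norm_num) (by linarith)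
  linarith [Real.log_two_gt_d9]

variable {ε : ℝ}

lemma apmδ_pos (hm : 0 < m) (hε : 0 < ε) : 0 < M.apmδ ε := by
  have h1 := one_le_two_mul_log hm
  have h2 := M.totalBudget_pos hm
  unfold apmδ
  positivity

lemma apmδ_mul (hm : 0 < m) : M.apmδ ε * Real.log ((m : ℝ) + 1) * M.totalBudget = ε / 2 := by
  have h1 := one_le_two_mul_log hm
  have h2 := M.totalBudget_pos hm
  have h3 : Real.log ((m : ℝ) + 1) ≠ 0 := by intro h; rw [h] at h1; linarith
  unfold apmδ
  field_simp

lemma apmδ_mul_totalBudget_le (hm : 0 < m) (hε : 0 < ε) :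
    M.apmδ ε * M.totalBudget ≤ ε := by
  have h1 := one_le_two_mul_log hm
  have h2 := M.apmδ_mul (ε := ε) hm
  have h3 := mul_pos (M.apmδ_pos hm hε) (M.totalBudget_pos hm)
  nlinarith

lemma exp_muLower_sub_lt (hm : 0 < m) : Real.exp (M.muLower k - 1) < M.pLower k := by
  conv_rhs => rw [← Real.exp_log (M.pLower_pos k hm)]
  exact Real.exp_lt_exp.2 (by simp [muLower])

lemma apmδ_mul_log_lt_one (hm : 0 < m) (hε' : ε ≤ Real.exp (M.muLower k - 1)) :
    M.apmδ ε * Real.log ((m : ℝ) + 1) < 1 := by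
  have h1 := M.apmδ_mul (ε := ε) hm
  have h2 := M.exp_muLower_sub_lt k hm
  have h3 := M.pLower_le_totalBudget k hm
  have h4 := M.totalBudget_pos hm
  by_contra! h
  nlinarith

/-! ### The minimizer of the smoothed objective lies in the interior of the relaxed box -/

/-- At the upper price bound demand falls short of the price: in the linear model it is at most the
total budget, and in the quasi-linear model every buyer prefers to keep the money. -/
lemma demand_lt_exp_of_eq_top (hm : 0 < m) (hε : 0 < ε)
    (hε' : ε ≤ Real.exp (M.muLower k - 1)) {μ : EuclideanSpace ℝ (Fin m)} {j : Fin m}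
    (hj : μ j = M.muUpper k + 1) : M.demand k (M.apmδ ε) μ j < Real.exp (μ j) := by
  have hU := M.pUpper_pos k hm
  have hexp : M.pUpper k < Real.exp (μ j) := by
    conv_lhs => rw [← Real.exp_log hU]
    exact Real.exp_lt_exp.2 (by rw [hj]; simp [muUpper])
  have hδ := M.apmδ_pos hm hε
  cases k with
  | linear =>
    rw [pUpper_linear] at hexp
    exact (M.demand_le_totalBudget _ _ μ j).trans_lt hexp
  | quasilinear =>
    have hshare : ∀ i, M.share .quasilinear (M.apmδ ε) μ i (some j) ≤ M.apmδ ε := by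
      intro i
      unfold share
      split_ifs with h
      · have hv : 0 < M.v i j := by simpa [activeIdx] using h
        have h1 : 1 ≤ ∑ o ∈ M.activeIdx .quasilinear i,
            Real.exp (M.logRatio μ i o / M.apmδ ε) := by
          have := Finset.single_le_sum (f := fun o => Real.exp (M.logRatio μ i o / M.apmδ ε))
            (s := M.activeIdx .quasilinear i) (a := none) (fun _ _ => (Real.exp_pos _).le)
            (by simp [activeIdx])
          simpa [logRatio] using this
        refine (div_le_self (Real.exp_pos _).le h1).trans ?_
        have h2 : M.logRatio μ i (some j) ≤ -1 := by
          have := Real.log_le_log hv (M.v_le_pUpper i j)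
          simp only [logRatio, hj, muUpper]
          linarith
        have h3 : Real.exp (M.logRatio μ i (some j) / M.apmδ ε) ≤ Real.exp (-(1 / M.apmδ ε)) := by
          rw [← neg_div]
          gcongr
        have h4 : 1 / M.apmδ ε ≤ Real.exp (1 / M.apmδ ε) := by
          linarith [Real.add_one_le_exp (1 / M.apmδ ε)]
        refine h3.trans ?_
        rw [Real.exp_neg]
        exact inv_le_of_inv_le₀ hδ (by simpa using h4)
      · exact hδ.le
    have h1 : M.demand .quasilinear (M.apmδ ε) μ j ≤ M.totalBudget * M.apmδ ε := by
      rw [totalBudget_eq, Finset.sum_mul]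
      exact Finset.sum_le_sum fun i _ => mul_le_mul_of_nonneg_left (hshare i) (M.B_pos i).le
    have h2 := M.apmδ_mul_totalBudget_le hm hε
    have h3 := M.exp_muLower_sub_lt .quasilinear hm
    have h4 := M.pLower_le_pUpper .quasilinear hm
    linarith

lemma share_none_le (δ : ℝ) (μ : EuclideanSpace ℝ (Fin m)) (i : Fin n) :
    M.share k δ μ i none ≤ k.invAlpha := by
  cases k with
  | linear => simp [share, activeIdx, UtilityKind.invAlpha]
  | quasilinear => exact M.share_le_one _ _ _ _ _

/-- The entropy of the shares is at most `log (m + 1)`, so the average log-ratio is within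
`δ log (m + 1)` of the largest one. -/
lemma logRatio_sub_le_sum_share_mul {δ : ℝ} (hδ : 0 < δ) (μ : EuclideanSpace ℝ (Fin m)) (i : Fin n)
    {o : Option (Fin m)} (ho : o ∈ M.activeIdx k i) :
    M.logRatio μ i o - δ * Real.log ((m : ℝ) + 1) ≤
      ∑ o', M.share k δ μ i o' * M.logRatio μ i o' := by
  have hs := M.share_nonneg k δ μ i
  have hs1 := M.sum_share k δ μ i
  have hent : ∑ o', M.share k δ μ i o' * -Real.log (M.share k δ μ i o') ≤
      Real.log ((m : ℝ) + 1) := by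
    refine (sum_mul_le_log_sum_mul_exp hs hs1).trans
      (Real.log_le_log (sum_mul_exp_pos hs hs1) ?_)
    calc _ ≤ ∑ _o' : Option (Fin m), (1 : ℝ) := by
          refine Finset.sum_le_sum fun o' _ => ?_
          rcases (hs o').eq_or_lt with h | h
          · rw [← h]; simp
          · rw [Real.exp_neg, Real.exp_log h, mul_inv_cancel₀ h.ne']
      _ = _ := by simp
  have hlog : ∀ o', M.share k δ μ i o' * -Real.log (M.share k δ μ i o') =
      M.share k δ μ i o' * M.lse k δ μ i - M.share k δ μ i o' * M.logRatio μ i o' / δ := by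
    intro o'
    by_cases h : o' ∈ M.activeIdx k i
    · have : Real.log (M.share k δ μ i o') = M.logRatio μ i o' / δ - M.lse k δ μ i := by
        rw [share, if_pos h, Real.log_div (Real.exp_pos _).ne' (M.sum_exp_pos k δ μ i).ne',
          Real.log_exp, lse]
      rw [this]
      ring
    · simp [share, h]
  simp only [hlog] at hent
  rw [Finset.sum_sub_distrib, ← Finset.sum_mul, hs1, one_mul, ← Finset.sum_div] at hent
  have hle : M.logRatio μ i o / δ ≤ M.lse k δ μ i := by
    rw [lse, Real.le_log_iff_exp_le (M.sum_exp_pos k δ μ i)]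
    exact Finset.single_le_sum (f := fun o => Real.exp (M.logRatio μ i o / δ))
      (fun _ _ => (Real.exp_pos _).le) ho
  have h := mul_le_mul_of_nonneg_left (hle.trans (by linarith : M.lse k δ μ i ≤
    Real.log ((m : ℝ) + 1) + (∑ o', M.share k δ μ i o' * M.logRatio μ i o') / δ)) hδ.le
  rw [mul_add, mul_div_cancel₀ _ hδ.ne', mul_div_cancel₀ _ hδ.ne'] at h
  linarith

/-- If demand exceeds supply nowhere, then all prices are above the lower bound: a buyer's average
utility per unit of money is at most `(‖v i‖₁ + α⁻¹ B i) / B i`, while a too cheap good would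
offer at least `e` times that. -/
lemma lt_of_demand_le (hm : 0 < m) {δ : ℝ} (hδ : 0 < δ)
    (hδ' : δ * Real.log ((m : ℝ) + 1) < 1) {μ : EuclideanSpace ℝ (Fin m)}
    (hμ : ∀ j, M.demand k δ μ j ≤ Real.exp (μ j)) (j : Fin m) : M.muLower k - 1 < μ j := by
  by_contra! hj
  obtain ⟨i, hi⟩ := M.exists_pLower_le k j
  have hP := M.pLower_pos k hm
  have hB := M.B_pos i
  have hW := M.wealth_pos k i
  have hv : 0 < M.v i j := by
    refine lt_of_le_of_ne (M.v_nonneg i j) fun h => ?_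
    rw [← h] at hi
    simp at hi
    linarith
  have ho : some j ∈ M.activeIdx k i := by simpa [activeIdx] using hv
  have hs := M.share_nonneg k δ μ i
  have hs1 := M.sum_share k δ μ i
  have hutil : ∑ o, M.share k δ μ i o * Real.exp (M.logRatio μ i o) ≤ M.wealth k i / M.B i := by
    rw [le_div_iff₀ hB, Finset.sum_mul, Fintype.sum_option, wealth, add_comm]
    refine add_le_add (Finset.sum_le_sum fun l _ => ?_) ?_
    · by_cases h : some l ∈ M.activeIdx k i
      · have hvl : 0 < M.v i l := by simpa [activeIdx] using h
        have hd : M.B i * M.share k δ μ i (some l) ≤ Real.exp (μ l) :=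
          (Finset.single_le_sum (f := fun i => M.B i * M.share k δ μ i (some l))
            (fun i _ => mul_nonneg (M.B_pos i).le (M.share_nonneg k δ μ i _))
            (Finset.mem_univ i)).trans (hμ l)
        rw [logRatio, Real.exp_sub, Real.exp_log hvl, abs_of_pos hvl]
        have he := Real.exp_pos (μ l)
        calc _ = M.v i l * (M.B i * M.share k δ μ i (some l)) / Real.exp (μ l) := by ring
          _ ≤ M.v i l * Real.exp (μ l) / Real.exp (μ l) := by gcongr
          _ = _ := by field_simp
      · simp [share, h]
    · simpa [logRatio] using mul_le_mul_of_nonneg_right (M.share_none_le k δ μ i) hB.le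
  have h1 := M.logRatio_sub_le_sum_share_mul k hδ μ i ho
  have h2 := sum_mul_le_log_sum_mul_exp (θ := M.logRatio μ i) hs hs1
  have h3 := Real.log_le_log (sum_mul_exp_pos (θ := M.logRatio μ i) hs hs1) hutil
  have h4 : Real.log (M.wealth k i / M.B i) ≤ M.logRatio μ i (some j) - 1 := by
    have h5 : M.wealth k i / M.B i ≤ M.v i j / M.pLower k := by
      rw [le_div_iff₀ hW] at hi
      rw [div_le_div_iff₀ hB hP]
      linarith
    have h6 := Real.log_le_log (div_pos hW hB) h5
    rw [Real.log_div hv.ne' hP.ne'] at h6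
    simp only [logRatio]
    unfold muLower at hj
    linarith
  linarith

/-- The relaxed box `[μ_lower - 1, μ_upper + 1]^m`. -/
def relaxedBox : Set (EuclideanSpace ℝ (Fin m)) :=
  {μ | ∀ j, M.muLower k - 1 ≤ μ j ∧ μ j ≤ M.muUpper k + 1}

lemma isCompact_relaxedBox : IsCompact (M.relaxedBox k) := by
  have h := (isCompact_Icc (a := fun _ : Fin m => M.muLower k - 1)
    (b := fun _ : Fin m => M.muUpper k + 1)).image (PiLp.continuous_toLp 2 fun _ : Fin m => ℝ)
  convert h using 1
  ext μ
  constructor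
  · intro hμ
    exact ⟨μ.ofLp, ⟨fun j => (hμ j).1, fun j => (hμ j).2⟩, rfl⟩
  · rintro ⟨f, hf, rfl⟩ j
    exact ⟨hf.1 j, hf.2 j⟩

/-- The first-order optimality condition at a minimizer of `Fδ` over the relaxed box, along
coordinate directions. -/
lemma excess_mul_sub_nonneg {δ : ℝ} (hδ : 0 < δ) {x : EuclideanSpace ℝ (Fin m)}
    (hx : x ∈ M.relaxedBox k) (hmin : ∀ p ∈ M.relaxedBox k, M.Fδ k δ x ≤ M.Fδ k δ p)
    (j : Fin m) {c : ℝ} (hc : M.muLower k - 1 ≤ c) (hc' : c ≤ M.muUpper k + 1) :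
    0 ≤ M.excess k δ x j * (c - x j) := by
  set d : EuclideanSpace ℝ (Fin m) := EuclideanSpace.single j (c - x j) with hd
  set K := (Real.exp (M.muUpper k + 1) + M.totalBudget / δ) / 2 * ‖d‖ ^ 2 with hK
  have hinner : inner ℝ (M.excess k δ x) d = M.excess k δ x j * (c - x j) := by
    rw [EuclideanSpace.inner_eq_sum_mul, Finset.sum_eq_single j]
    · simp [hd]
    · intro l _ hl
      simp [hd, hl]
    · simp
  have hstep : ∀ t : ℝ, 0 < t → t ≤ 1 → 0 ≤ M.excess k δ x j * (c - x j) + K * t := by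
    intro t ht ht1
    have hp : x + t • d ∈ M.relaxedBox k := by
      intro l
      rcases eq_or_ne l j with rfl | hl
      · have h := hx l
        have e : (x + t • d) l = (1 - t) * x l + t * c := by simp [hd]; ring
        rw [e]
        constructor <;> nlinarith
      · simpa [hd, hl] using hx l
    have h1 := hmin _ hp
    have h2 := M.Fδ_le k hδ (fun l => (hp l).2) (fun l => (hx l).2)
    rw [add_sub_cancel_left, real_inner_smul_right, hinner, norm_smul, Real.norm_of_nonneg ht.le]
      at h2
    have h3 : 0 ≤ t * (M.excess k δ x j * (c - x j) + K * t) := by rw [hK]; linarith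
    exact nonneg_of_mul_nonneg_right h3 ht
  by_contra! h
  have hK0 : 0 ≤ K := by
    have : 0 ≤ M.totalBudget := Finset.sum_nonneg fun _ _ => abs_nonneg _
    positivity
  set a := M.excess k δ x j * (c - x j)
  have h1 := hstep (min 1 (-a / (2 * (K + 1))))
    (lt_min one_pos (div_pos (by linarith) (by linarith))) (min_le_left _ _)
  have h2 : K * min 1 (-a / (2 * (K + 1))) ≤ K * (-a / (2 * (K + 1))) :=
    mul_le_mul_of_nonneg_left (min_le_right _ _) hK0
  have h3 : K * (-a / (2 * (K + 1))) ≤ -a / 2 := by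
    rw [← mul_div_assoc, div_le_div_iff₀ (by linarith) (by norm_num)]
    nlinarith
  linarith

lemma exists_excess_eq_zero (hm : 0 < m) (hε : 0 < ε) (hε' : ε ≤ Real.exp (M.muLower k - 1)) :
    ∃ x ∈ M.relaxedBox k, M.excess k (M.apmδ ε) x = 0 := by
  have hδ := M.apmδ_pos hm hε
  have hlu := M.muLower_le_muUpper k hm
  obtain ⟨x, hx, hmin⟩ := (M.isCompact_relaxedBox k).exists_isMinOn
    ⟨WithLp.toLp 2 fun _ => M.muLower k, fun j => ⟨by simp, by simp; linarith⟩⟩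
    (M.continuous_Fδ k hδ).continuousOn
  have hvar := fun j c => M.excess_mul_sub_nonneg k hδ hx (fun p hp => hmin hp) j (c := c)
  refine ⟨x, hx, ?_⟩
  have htop : ∀ j, x j < M.muUpper k + 1 := by
    intro j
    refine lt_of_le_of_ne (hx j).2 fun h => ?_
    have h1 := M.demand_lt_exp_of_eq_top k hm hε hε' h
    have h2 := hvar j (M.muLower k - 1) le_rfl (by linarith)
    simp only [excess] at h2
    nlinarith
  have hnonneg : ∀ j, 0 ≤ M.excess k (M.apmδ ε) x j := fun j =>
    nonneg_of_mul_nonneg_left (hvar j (M.muUpper k + 1) (by linarith) le_rfl)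
      (by linarith [htop j])
  have hbot := M.lt_of_demand_le k hm hδ (M.apmδ_mul_log_lt_one k hm hε') (μ := x) fun j => by
    have := hnonneg j
    simp only [excess] at this
    linarith
  ext j
  refine le_antisymm ?_ (hnonneg j)
  have h1 := hvar j (M.muLower k - 1) le_rfl (by linarith)
  have h2 := hbot j
  simp only [PiLp.zero_apply]
  by_contra! h
  nlinarith

end Bounds

end FisherMarket

namespace FisherMarket

/-! ### The momentum coefficient and the projected gradient step -/

section Step

variable {n m : ℕ} (M : FisherMarket n m) (k : UtilityKind) {ε : ℝ}

lemma apmσ_eq : M.apmσ k = Real.exp (M.muLower k - 1) := rfl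

lemma apmσ_pos : 0 < M.apmσ k := Real.exp_pos _

lemma apmL_eq : M.apmL k ε = Real.exp (M.muUpper k + 1) + M.totalBudget / M.apmδ ε := rfl

lemma apmσ_lt_apmL (hm : 0 < m) (hε : 0 < ε) : M.apmσ k < M.apmL k ε := by
  rw [apmL_eq, apmσ_eq]
  have h1 := div_pos (M.totalBudget_pos hm) (M.apmδ_pos hm hε)
  have h2 : Real.exp (M.muLower k - 1) ≤ Real.exp (M.muUpper k + 1) :=
    Real.exp_le_exp.2 (by linarith [M.muLower_le_muUpper k hm])
  linarith

lemma apmL_pos (hm : 0 < m) (hε : 0 < ε) : 0 < M.apmL k ε :=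
  (M.apmσ_pos k).trans (M.apmσ_lt_apmL k hm hε)

lemma apmq_pos (hm : 0 < m) (hε : 0 < ε) : 0 < M.apmq k ε :=
  div_pos (M.apmσ_pos k) (M.apmL_pos k hm hε)

lemma sqrt_apmq_pos (hm : 0 < m) (hε : 0 < ε) : 0 < √(M.apmq k ε) :=
  Real.sqrt_pos.2 (M.apmq_pos k hm hε)

lemma sqrt_apmq_lt_one (hm : 0 < m) (hε : 0 < ε) : √(M.apmq k ε) < 1 := by
  rw [Real.sqrt_lt' one_pos, one_pow, apmq, div_lt_one (M.apmL_pos k hm hε)]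
  exact M.apmσ_lt_apmL k hm hε

lemma apmL_mul_sqrt_apmq_sq (hm : 0 < m) (hε : 0 < ε) :
    M.apmL k ε * √(M.apmq k ε) ^ 2 = M.apmσ k := by
  rw [Real.sq_sqrt (M.apmq_pos k hm hε).le, apmq, mul_div_cancel₀ _ (M.apmL_pos k hm hε).ne']

/-- Demand moves a log-price up by at most `√q` in one gradient step. -/
lemma totalBudget_div_apmL_le (hm : 0 < m) (hε : 0 < ε)
    (hε' : ε ≤ Real.exp (M.muLower k - 1)) :
    M.totalBudget / M.apmL k ε ≤ √(M.apmq k ε) := by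
  have hL := M.apmL_pos k hm hε
  have hb := M.totalBudget_pos hm
  have hδ := M.apmδ_pos hm hε
  rw [apmq]
  refine Real.le_sqrt_of_sq_le ?_
  rw [div_pow, div_le_div_iff₀ (by positivity) hL]
  have h1 : M.totalBudget / M.apmδ ε ≤ M.apmL k ε := by
    rw [apmL_eq]
    linarith [Real.exp_pos (M.muUpper k + 1)]
  rw [div_le_iff₀ hδ] at h1
  have h2 := (M.apmδ_mul_totalBudget_le hm hε).trans hε'
  rw [← apmσ_eq] at h2
  have h3 : M.totalBudget ^ 2 ≤ M.apmσ k * M.apmL k ε := by nlinarith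
  nlinarith

lemma gradStep_apply (hm : 0 < m) (hε : 0 < ε) (y : EuclideanSpace ℝ (Fin m)) (j : Fin m) :
    M.gradStep k ε y j = max (M.muLower k - 1)
      (min (y j - 1 / M.apmL k ε * M.excess k (M.apmδ ε) y j) (M.muUpper k + 1)) := by
  rw [← M.gradient_Fδ k (M.apmδ_pos hm hε)]
  rfl

lemma gradStep_mem (hm : 0 < m) (hε : 0 < ε) (y : EuclideanSpace ℝ (Fin m)) :
    M.gradStep k ε y ∈ M.relaxedBox k := by
  intro j
  rw [M.gradStep_apply k hm hε]
  exact ⟨le_max_left _ _, max_le (by linarith [M.muLower_le_muUpper k hm]) (min_le_right _ _)⟩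

lemma clip_sub_mul_nonneg {lo hi z p : ℝ} (h₁ : lo ≤ p) (h₂ : p ≤ hi) :
    0 ≤ (max lo (min z hi) - z) * (p - max lo (min z hi)) := by
  rcases le_total z hi with h | h
  · rw [min_eq_left h]
    rcases le_total lo z with h' | h'
    · rw [max_eq_right h']; simp
    · rw [max_eq_left h']; exact mul_nonneg (by linarith) (by linarith)
  · rw [min_eq_right h, max_eq_right (by linarith)]
    exact mul_nonneg_of_nonpos_of_nonpos (by linarith) (by linarith)

/-- The variational inequality of the projection onto the relaxed box. -/
lemma inner_excess_gradStep_le (hm : 0 < m) (hε : 0 < ε) (y : EuclideanSpace ℝ (Fin m))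
    {p : EuclideanSpace ℝ (Fin m)} (hp : p ∈ M.relaxedBox k) :
    inner ℝ (M.excess k (M.apmδ ε) y) (M.gradStep k ε y - p) ≤
      M.apmL k ε * inner ℝ (y - M.gradStep k ε y) (M.gradStep k ε y - p) := by
  have hL := M.apmL_pos k hm hε
  rw [EuclideanSpace.inner_eq_sum_mul, EuclideanSpace.inner_eq_sum_mul, Finset.mul_sum]
  refine Finset.sum_le_sum fun j _ => ?_
  have h := mul_nonneg hL.le (clip_sub_mul_nonneg
    (z := y j - 1 / M.apmL k ε * M.excess k (M.apmδ ε) y j) (hp j).1 (hp j).2)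
  rw [← M.gradStep_apply k hm hε] at h
  simp only [PiLp.sub_apply]
  have e : M.apmL k ε * ((M.gradStep k ε y j -
        (y j - 1 / M.apmL k ε * M.excess k (M.apmδ ε) y j)) * (p j - M.gradStep k ε y j))
      = M.apmL k ε * ((y j - M.gradStep k ε y j) * (M.gradStep k ε y j - p j))
        - M.excess k (M.apmδ ε) y j * (M.gradStep k ε y j - p j) := by
    field_simp
    ring
  linarith

/-- The descent inequality of the projected gradient step. -/
lemma Fδ_gradStep_le (hm : 0 < m) (hε : 0 < ε) {y p : EuclideanSpace ℝ (Fin m)}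
    (hy : ∀ j, y j ≤ M.muUpper k + 1 + 1 / 2) (hp : p ∈ M.relaxedBox k) :
    M.Fδ k (M.apmδ ε) (M.gradStep k ε y) ≤ M.Fδ k (M.apmδ ε) p +
      M.apmL k ε * inner ℝ (y - M.gradStep k ε y) (y - p) -
        M.apmL k ε / 2 * ‖y - M.gradStep k ε y‖ ^ 2 := by
  have h1 := M.Fδ_step_le k (M.apmδ_pos hm hε) (fun j => (hp j).2)
    (fun j => (M.gradStep_mem k hm hε y j).2) hy
  have h2 := M.inner_excess_gradStep_le k hm hε y hp
  have h3 : inner ℝ (y - M.gradStep k ε y) (M.gradStep k ε y - p) =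
      inner ℝ (y - M.gradStep k ε y) (y - p) - ‖y - M.gradStep k ε y‖ ^ 2 := by
    rw [← real_inner_self_eq_norm_sq, ← inner_sub_right]
    congr 1
    abel
  rw [← apmL_eq, norm_sub_rev (M.gradStep k ε y) y] at h1
  rw [h3] at h2
  linarith

lemma gradStep_sub_le (hm : 0 < m) (hε : 0 < ε) (hε' : ε ≤ Real.exp (M.muLower k - 1))
    {x y : EuclideanSpace ℝ (Fin m)} (hx : x ∈ M.relaxedBox k) (j : Fin m) :
    M.gradStep k ε y j - x j ≤ max 0 (y j - x j + √(M.apmq k ε)) := by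
  have hL := M.apmL_pos k hm hε
  have h1 : -(1 / M.apmL k ε * M.excess k (M.apmδ ε) y j) ≤ √(M.apmq k ε) := by
    refine le_trans ?_ (M.totalBudget_div_apmL_le k hm hε hε')
    have := M.neg_totalBudget_le_excess k (M.apmδ ε) y j
    rw [one_div_mul_eq_div, ← neg_div]
    gcongr
    linarith
  rw [M.gradStep_apply k hm hε, sub_le_iff_le_add]
  refine max_le ?_ ((min_le_left _ _).trans ?_)
  · linarith [(hx j).1, le_max_left 0 (y j - x j + √(M.apmq k ε))]
  · linarith [le_max_right 0 (y j - x j + √(M.apmq k ε))]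

/-- The gradient is controlled by the objective gap, by comparing `x` with a short gradient step
from `x`, which stays below `μ_upper + 2`. -/
lemma norm_excess_sq_le (hm : 0 < m) (hε : 0 < ε) (hε' : ε ≤ Real.exp (M.muLower k - 1))
    {x x₀ : EuclideanSpace ℝ (Fin m)} (hx : x ∈ M.relaxedBox k)
    (hmin : ∀ p, M.Fδ k (M.apmδ ε) x₀ ≤ M.Fδ k (M.apmδ ε) p) :
    ‖M.excess k (M.apmδ ε) x‖ ^ 2 ≤
      2 * Real.exp 1 * M.apmL k ε * (M.Fδ k (M.apmδ ε) x - M.Fδ k (M.apmδ ε) x₀) := by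
  have hL := M.apmL_pos k hm hε
  have hb := M.totalBudget_pos hm
  have hδ := M.apmδ_pos hm hε
  set g := M.excess k (M.apmδ ε) x
  have he : 1 ≤ Real.exp 1 := Real.one_le_exp (by norm_num)
  set K := Real.exp 1 * M.apmL k ε with hK
  have hLK : M.apmL k ε ≤ K := le_mul_of_one_le_left hL.le he
  have hK0 : 0 < K := hL.trans_le hLK
  have hKexp : Real.exp (M.muUpper k + 1 + 1) + M.totalBudget / M.apmδ ε ≤ K := by
    rw [hK, apmL_eq, Real.exp_add _ 1, mul_add, mul_comm (Real.exp 1)]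
    have := le_mul_of_one_le_left (div_pos hb hδ).le he
    linarith
  have hp : ∀ j, (x - (1 / K) • g) j ≤ M.muUpper k + 1 + 1 := by
    intro j
    have h1 := M.neg_totalBudget_le_excess k (M.apmδ ε) x j
    have h2 : -(1 / K * g j) ≤ 1 := by
      calc -(1 / K * g j) = -g j / K := by ring
        _ ≤ M.totalBudget / M.apmL k ε :=
          div_le_div₀ hb.le (by linarith) hL hLK
        _ ≤ 1 := (M.totalBudget_div_apmL_le k hm hε hε').trans
          (M.sqrt_apmq_lt_one k hm hε).le
    simp only [PiLp.sub_apply, PiLp.smul_apply, smul_eq_mul]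
    linarith [(hx j).2]
  have h := M.Fδ_le k hδ hp (fun j => by linarith [(hx j).2])
  have h0 := hmin (x - (1 / K) • g)
  rw [show x - (1 / K) • g - x = -((1 / K) • g) by abel, inner_neg_right, real_inner_smul_right,
    norm_neg, norm_smul, real_inner_self_eq_norm_sq, Real.norm_of_nonneg (by positivity)] at h
  have h2 : (Real.exp (M.muUpper k + 1 + 1) + M.totalBudget / M.apmδ ε) / 2 *
      (1 / K * ‖g‖) ^ 2 ≤ K / 2 * (1 / K * ‖g‖) ^ 2 := by gcongr
  have h3 : K / 2 * (1 / K * ‖g‖) ^ 2 = 1 / K * ‖g‖ ^ 2 / 2 := by field_simp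
  have h4 : 1 / K * ‖g‖ ^ 2 ≤ 2 * (M.Fδ k (M.apmδ ε) x - M.Fδ k (M.apmδ ε) x₀) := by linarith
  have h5 := mul_le_mul_of_nonneg_left h4 hK0.le
  rw [← mul_assoc, mul_one_div_cancel hK0.ne', one_mul] at h5
  linarith

/-! ### Convergence of the iterates -/

/-- Along the iteration the iterates stay in the relaxed box, the query points exceed it from above
by at most `1/2`, and the Lyapunov function decays geometrically. The increment `v` is that of the
previous step, and `0` at the start. -/
lemma apmIter_invariant (hm : 0 < m) (hε : 0 < ε) (hε' : ε ≤ Real.exp (M.muLower k - 1))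
    {μ₀ x₀ : EuclideanSpace ℝ (Fin m)} (hμ₀ : μ₀ ∈ M.relaxedBox k) (hx₀ : x₀ ∈ M.relaxedBox k)
    (hgrad : M.excess k (M.apmδ ε) x₀ = 0) (t : ℕ) :
    (M.apmIter k ε μ₀ t).1 ∈ M.relaxedBox k ∧ ∃ v : EuclideanSpace ℝ (Fin m),
      (M.apmIter k ε μ₀ t).2 = (M.apmIter k ε μ₀ t).1 +
        ((1 - √(M.apmq k ε)) / (1 + √(M.apmq k ε))) • v ∧
      (∀ j, (1 - √(M.apmq k ε)) / (1 + √(M.apmq k ε)) * v j ≤ 1 / 2) ∧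
      lyapunov (M.apmL k ε) √(M.apmq k ε)
          (M.Fδ k (M.apmδ ε) (M.apmIter k ε μ₀ t).1 - M.Fδ k (M.apmδ ε) x₀)
          ((M.apmIter k ε μ₀ t).1 - x₀) v ≤
        (1 - √(M.apmq k ε) / 8) ^ t * lyapunov (M.apmL k ε) √(M.apmq k ε)
          (M.Fδ k (M.apmδ ε) μ₀ - M.Fδ k (M.apmδ ε) x₀) (μ₀ - x₀) 0 := by
  have hs0 := M.sqrt_apmq_pos k hm hε
  have hs1 := M.sqrt_apmq_lt_one k hm hε
  have hL := M.apmL_pos k hm hε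
  set s := √(M.apmq k ε) with hs
  set β := (1 - s) / (1 + s) with hβ
  have hβ0 : 0 < β := div_pos (by linarith) (by linarith)
  have hβs : β * (1 + s) = 1 - s := by rw [hβ]; field_simp
  induction t with
  | zero => exact ⟨hμ₀, 0, by simp [apmIter], by simp, by simp [apmIter]⟩
  | succ t ih =>
    obtain ⟨hx, v, hyv, hv, hlyap⟩ := ih
    set x := (M.apmIter k ε μ₀ t).1
    set y := (M.apmIter k ε μ₀ t).2
    have e1 : (M.apmIter k ε μ₀ (t + 1)).1 = M.gradStep k ε y := rfl
    have e2 : (M.apmIter k ε μ₀ (t + 1)).2 =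
        M.gradStep k ε y + β • (M.gradStep k ε y - x) := rfl
    rw [e1, e2]
    have hyx : ∀ j, y j - x j = β * v j := fun j => by rw [hyv]; simp
    have hytop : ∀ j, y j ≤ M.muUpper k + 1 + 1 / 2 := fun j => by
      linarith [hyx j, hv j, (hx j).2]
    refine ⟨M.gradStep_mem k hm hε y, M.gradStep k ε y - x, rfl, fun j => ?_, ?_⟩
    · -- `1/2` is invariant: `β (1/2 + s) ≤ 1/2` for `β = (1 - s) / (1 + s)`.
      have h1 := M.gradStep_sub_le k hm hε hε' (y := y) hx j
      rw [hyx j] at h1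
      have h2 : M.gradStep k ε y j - x j ≤ 1 / 2 + s :=
        h1.trans (max_le (by linarith) (by linarith [hv j]))
      rw [PiLp.sub_apply]
      refine (mul_le_mul_of_nonneg_left h2 hβ0.le).trans ?_
      rw [hβ, div_mul_eq_mul_div, div_le_iff₀ (by linarith)]
      nlinarith
    · set a := y - M.gradStep k ε y with ha
      have hinc : M.gradStep k ε y - x = β • v - a := by rw [ha, hyv]; abel
      have hdisp : M.gradStep k ε y - x₀ = (x - x₀) + (β • v - a) := by rw [← hinc]; abel
      rw [hdisp, hinc]
      have h₁ := M.Fδ_gradStep_le k hm hε hytop hx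
      have h₂ := M.Fδ_gradStep_le k hm hε hytop hx₀
      have i1 : inner ℝ a (y - x) = β * inner ℝ a v := by
        rw [← real_inner_smul_right]
        congr 1
        rw [hyv]
        abel
      have i2 : inner ℝ a (y - x₀) = inner ℝ a (x - x₀) + β * inner ℝ a v := by
        rw [← i1, ← inner_add_right]
        congr 1
        abel
      have hg := M.Fδ_ge k (M.apmδ_pos hm hε) (fun j => (hx j).1) (fun j => (hx₀ j).1)
      rw [hgrad, inner_zero_left, ← apmσ_eq, ← M.apmL_mul_sqrt_apmq_sq k hm hε] at hg
      rw [← ha, i1] at h₁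
      rw [← ha, i2] at h₂
      have hstep := lyapunov_step (e := x - x₀) (v := v) (a := a) hL hs0 hs1 hβ
        (f := M.Fδ k (M.apmδ ε) x - M.Fδ k (M.apmδ ε) x₀)
        (f' := M.Fδ k (M.apmδ ε) (M.gradStep k ε y) - M.Fδ k (M.apmδ ε) x₀)
        (by linarith) (by linarith) (by linarith)
      refine hstep.trans ?_
      rw [pow_succ' _ t, mul_assoc]
      exact mul_le_mul_of_nonneg_left hlyap (by linarith)

/-- The squared diameter of the relaxed box. -/
noncomputable def boxDiamSq : ℝ := m * (M.muUpper k - M.muLower k + 2) ^ 2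

lemma norm_sub_sq_le {x y : EuclideanSpace ℝ (Fin m)} (hx : x ∈ M.relaxedBox k)
    (hy : y ∈ M.relaxedBox k) : ‖x - y‖ ^ 2 ≤ M.boxDiamSq k := by
  rw [EuclideanSpace.real_norm_sq_eq]
  calc ∑ j, (x - y) j ^ 2 ≤ ∑ _j : Fin m, (M.muUpper k - M.muLower k + 2) ^ 2 := by
        refine Finset.sum_le_sum fun j _ => ?_
        rw [PiLp.sub_apply]
        exact sq_le_sq' (by linarith [(hx j).1, (hy j).2]) (by linarith [(hx j).2, (hy j).1])
    _ = _ := by simp [boxDiamSq]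

lemma boxDiamSq_pos (hm : 0 < m) : 0 < M.boxDiamSq k := by
  have h1 := M.muLower_le_muUpper k hm
  have h2 : (0 : ℝ) < m := by exact_mod_cast hm
  unfold boxDiamSq
  have : 0 < M.muUpper k - M.muLower k + 2 := by linarith
  positivity

lemma lyapunov_initial_le (hm : 0 < m) (hε : 0 < ε) {μ₀ x₀ : EuclideanSpace ℝ (Fin m)}
    (hμ₀ : μ₀ ∈ M.relaxedBox k) (hx₀ : x₀ ∈ M.relaxedBox k)
    (hgrad : M.excess k (M.apmδ ε) x₀ = 0) :
    lyapunov (M.apmL k ε) √(M.apmq k ε)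
      (M.Fδ k (M.apmδ ε) μ₀ - M.Fδ k (M.apmδ ε) x₀) (μ₀ - x₀) 0 ≤
        3 / 2 * M.apmL k ε * M.boxDiamSq k := by
  have hs0 := M.sqrt_apmq_pos k hm hε
  have hs1 := M.sqrt_apmq_lt_one k hm hε
  have hL := M.apmL_pos k hm hε
  set s := √(M.apmq k ε)
  have h1 := M.Fδ_le k (M.apmδ_pos hm hε) (fun j => (hμ₀ j).2) (fun j => (hx₀ j).2)
  rw [hgrad, inner_zero_left, ← apmL_eq] at h1
  have h2 := M.norm_sub_sq_le k hμ₀ hx₀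
  have h3 : M.apmL k ε / (2 * (1 + s)) * (s ^ 2 * ‖μ₀ - x₀‖ ^ 2 + s ^ 2 * ‖μ₀ - x₀‖ ^ 2) ≤
      M.apmL k ε / 2 * (2 * ‖μ₀ - x₀‖ ^ 2) := by
    have hs2 : s ^ 2 ≤ 1 := by nlinarith
    have h4 : s ^ 2 * ‖μ₀ - x₀‖ ^ 2 ≤ ‖μ₀ - x₀‖ ^ 2 := mul_le_of_le_one_left (sq_nonneg _) hs2
    refine mul_le_mul (div_le_div_of_nonneg_left hL.le (by norm_num) (by linarith))
      (by linarith) (by positivity) (by positivity)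
  have h4 : M.apmL k ε * ‖μ₀ - x₀‖ ^ 2 ≤ M.apmL k ε * M.boxDiamSq k := by gcongr
  unfold lyapunov
  rw [smul_zero, add_zero, norm_smul, Real.norm_of_nonneg hs0.le, mul_pow]
  linarith

lemma min_mul_le_threshold (hε : 0 < ε) (hε' : ε ≤ Real.exp (M.muLower k - 1)) :
    min (M.apmσ k) 1 * ε ≤ min (M.apmσ k * ε) √(M.apmσ k * ε) := by
  refine le_min (mul_le_mul_of_nonneg_right (min_le_left _ _) hε.le) ?_
  refine (mul_le_mul_of_nonneg_right (min_le_right _ _) hε.le).trans ?_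
  rw [one_mul]
  refine Real.le_sqrt_of_sq_le ?_
  rw [sq]
  exact mul_le_mul_of_nonneg_right hε' hε.le

/-- A market constant that bounds `ε * L`. -/
noncomputable def smoothnessConst : ℝ :=
  Real.exp (M.muUpper k + 1) * M.apmσ k +
    2 * Real.log ((m : ℝ) + 1) * M.totalBudget ^ 2

lemma smoothnessConst_pos (hm : 0 < m) : 0 < M.smoothnessConst k := by
  have h1 := one_le_two_mul_log hm
  have h2 := M.totalBudget_pos hm
  have h3 := M.apmσ_pos k
  unfold smoothnessConst
  positivity

lemma apmL_le_div (hm : 0 < m) (hε : 0 < ε) (hε' : ε ≤ Real.exp (M.muLower k - 1)) :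
    M.apmL k ε ≤ M.smoothnessConst k / ε := by
  have h1 := one_le_two_mul_log hm
  have h2 := M.totalBudget_pos hm
  rw [le_div_iff₀ hε, apmL_eq, smoothnessConst, add_mul]
  refine add_le_add (mul_le_mul_of_nonneg_left hε' (Real.exp_pos _).le) (le_of_eq ?_)
  unfold apmδ
  have h3 : Real.log ((m : ℝ) + 1) ≠ 0 := by intro h; rw [h] at h1; linarith
  field_simp

/-- The market constant in the logarithm of the iteration bound. -/
noncomputable def logConst : ℝ :=
  3 * Real.exp 1 * M.smoothnessConst k ^ 2 * M.boxDiamSq k / min (M.apmσ k) 1 ^ 2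

lemma logConst_pos (hm : 0 < m) : 0 < M.logConst k := by
  have h1 := M.smoothnessConst_pos k hm
  have h2 := M.boxDiamSq_pos k hm
  have h3 : 0 < min (M.apmσ k) 1 := lt_min (M.apmσ_pos k) one_pos
  unfold logConst
  positivity

lemma stops_of_le (hm : 0 < m) (hε : 0 < ε) (hε' : ε ≤ Real.exp (M.muLower k - 1))
    {μ₀ : EuclideanSpace ℝ (Fin m)} (hμ₀ : μ₀ ∈ M.relaxedBox k) {t : ℕ}
    (ht : 8 * (|Real.log (M.logConst k)| + 4 * |Real.log ε|) / √(M.apmq k ε) ≤ t) :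
    M.Stops k ε (M.apmIter k ε μ₀ t).1 := by
  obtain ⟨x₀, hx₀, hgrad⟩ := M.exists_excess_eq_zero k hm hε hε'
  have hδ := M.apmδ_pos hm hε
  have hmin : ∀ p, M.Fδ k (M.apmδ ε) x₀ ≤ M.Fδ k (M.apmδ ε) p := fun p => by
    have := M.Fδ_tangent_le k hδ p x₀
    rwa [hgrad, inner_zero_left, add_zero] at this
  obtain ⟨hx, v, -, -, hlyap⟩ := M.apmIter_invariant k hm hε hε' hμ₀ hx₀ hgrad t
  have hinit := M.lyapunov_initial_le k hm hε hμ₀ hx₀ hgrad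
  have hs0 := M.sqrt_apmq_pos k hm hε
  have hs1 := M.sqrt_apmq_lt_one k hm hε
  have hL := M.apmL_pos k hm hε
  have hD := M.boxDiamSq_pos k hm
  have hc := M.logConst_pos k hm
  have hSm := M.smoothnessConst_pos k hm
  have hLle := M.apmL_le_div k hm hε hε'
  set s := √(M.apmq k ε)
  set x := (M.apmIter k ε μ₀ t).1
  have hgapΦ : M.Fδ k (M.apmδ ε) x - M.Fδ k (M.apmδ ε) x₀ ≤
      lyapunov (M.apmL k ε) s (M.Fδ k (M.apmδ ε) x - M.Fδ k (M.apmδ ε) x₀) (x - x₀) v :=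
    le_add_of_nonneg_right (by positivity)
  have hdecay : (1 - s / 8) ^ t ≤ ε ^ 4 / M.logConst k := by
    have h1 : (1 - s / 8) ^ t ≤ Real.exp (-(s / 8)) ^ t :=
      pow_le_pow_left₀ (by linarith) (by linarith [Real.add_one_le_exp (-(s / 8))]) t
    refine h1.trans ?_
    rw [← Real.exp_nat_mul, ← Real.exp_log (show 0 < ε ^ 4 / M.logConst k by positivity)]
    refine Real.exp_le_exp.2 ?_
    rw [Real.log_div (by positivity) hc.ne', Real.log_pow]
    rw [div_le_iff₀ hs0] at ht
    push_cast
    linarith [le_abs_self (Real.log (M.logConst k)), neg_abs_le (Real.log ε)]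
  have hgap : M.Fδ k (M.apmδ ε) x - M.Fδ k (M.apmδ ε) x₀ ≤
      ε ^ 4 / M.logConst k * (3 / 2 * M.apmL k ε * M.boxDiamSq k) := by
    refine hgapΦ.trans (hlyap.trans ?_)
    refine (mul_le_mul_of_nonneg_left hinit (pow_nonneg (by linarith) t)).trans ?_
    exact mul_le_mul_of_nonneg_right hdecay (by positivity)
  have hκ : 0 < min (M.apmσ k) 1 := lt_min (M.apmσ_pos k) one_pos
  have hnorm : ‖M.excess k (M.apmδ ε) x‖ ^ 2 ≤ (min (M.apmσ k) 1 * ε) ^ 2 := by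
    calc _ ≤ 2 * Real.exp 1 * M.apmL k ε *
          (M.Fδ k (M.apmδ ε) x - M.Fδ k (M.apmδ ε) x₀) :=
          M.norm_excess_sq_le k hm hε hε' hx hmin
      _ ≤ 2 * Real.exp 1 * M.apmL k ε *
          (ε ^ 4 / M.logConst k * (3 / 2 * M.apmL k ε * M.boxDiamSq k)) := by gcongr
      _ = ε ^ 4 * (3 * Real.exp 1 * M.boxDiamSq k) / M.logConst k * M.apmL k ε ^ 2 := by ring
      _ ≤ ε ^ 4 * (3 * Real.exp 1 * M.boxDiamSq k) / M.logConst k *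
          (M.smoothnessConst k / ε) ^ 2 := by gcongr
      _ = _ := by
        unfold logConst
        field_simp
  rw [Stops, M.gradient_Fδ k hδ]
  refine le_trans ?_ (M.min_mul_le_threshold k hε hε')
  exact (pow_le_pow_iff_left₀ (norm_nonneg _) (by positivity) two_ne_zero).1 hnorm

/-- At a stopping point strong convexity bounds the gap of `Fδ` by `ε / 2`, and smoothing
costs at most another `ε / 2`. -/
lemma isApproxCE_of_stops (hm : 0 < m) (hε : 0 < ε) (hε' : ε ≤ Real.exp (M.muLower k - 1))
    {x : EuclideanSpace ℝ (Fin m)} (hx : x ∈ M.relaxedBox k) (hst : M.Stops k ε x) :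
    M.IsApproxCE k ε fun j => Real.exp (x j) := by
  obtain ⟨x₀, hx₀, hgrad⟩ := M.exists_excess_eq_zero k hm hε hε'
  have hδ := M.apmδ_pos hm hε
  have hσ := M.apmσ_pos k
  have hlow : ∀ ν, M.Fδ k (M.apmδ ε) x₀ - ε / 2 ≤ M.F k ν := fun ν => by
    have h1 := M.Fδ_tangent_le k hδ ν x₀
    rw [hgrad, inner_zero_left, add_zero] at h1
    have h2 := M.Fδ_le_F_add k hδ ν
    rw [M.apmδ_mul hm] at h2
    linarith
  have hbdd : BddBelow (Set.range (M.F k)) :=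
    ⟨M.Fδ k (M.apmδ ε) x₀ - ε / 2, by rintro _ ⟨ν, rfl⟩; exact hlow ν⟩
  refine ⟨fun j => Real.exp_pos _, hbdd, ?_⟩
  have hlog : (WithLp.toLp 2 fun j => Real.log (Real.exp (x j)) : EuclideanSpace ℝ (Fin m)) = x := by
    ext j
    simp
  rw [hlog]
  have hinf : M.Fδ k (M.apmδ ε) x₀ - ε / 2 ≤ ⨅ ν, M.F k ν := le_ciInf hlow
  have hF := M.F_le_Fδ k hδ x
  rw [Stops, M.gradient_Fδ k hδ] at hst
  set g := M.excess k (M.apmδ ε) x with hgdef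
  have hg2 : ‖g‖ ^ 2 ≤ M.apmσ k * ε := by
    rw [← Real.sq_sqrt (mul_pos hσ hε).le]
    exact pow_le_pow_left₀ (norm_nonneg _) (hst.trans (min_le_right _ _)) 2
  have hsc := M.Fδ_ge k hδ (fun j => (hx₀ j).1) (fun j => (hx j).1)
  rw [← apmσ_eq, ← hgdef] at hsc
  have hcs : -(‖g‖ * ‖x₀ - x‖) ≤ inner ℝ g (x₀ - x) :=
    (abs_le.1 (abs_real_inner_le_norm g (x₀ - x))).1
  have hgap : M.Fδ k (M.apmδ ε) x - M.Fδ k (M.apmδ ε) x₀ ≤ ε / 2 := by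
    have h1 : ‖g‖ * ‖x₀ - x‖ ≤ ‖g‖ ^ 2 / (2 * M.apmσ k) + M.apmσ k / 2 * ‖x₀ - x‖ ^ 2 := by
      have e : ‖g‖ ^ 2 / (2 * M.apmσ k) + M.apmσ k / 2 * ‖x₀ - x‖ ^ 2 - ‖g‖ * ‖x₀ - x‖ =
          (‖g‖ - M.apmσ k * ‖x₀ - x‖) ^ 2 / (2 * M.apmσ k) := by field_simp; ring
      have : 0 ≤ (‖g‖ - M.apmσ k * ‖x₀ - x‖) ^ 2 / (2 * M.apmσ k) := by positivity
      linarith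
    have h2 : ‖g‖ ^ 2 / (2 * M.apmσ k) ≤ ε / 2 := by
      rw [div_le_div_iff₀ (by positivity) (by norm_num)]
      linarith
    linarith
  linarith

lemma inv_sqrt_apmq_le (hm : 0 < m) (hε : 0 < ε) (hε' : ε ≤ Real.exp (M.muLower k - 1)) :
    1 / √(M.apmq k ε) ≤ √(M.smoothnessConst k / M.apmσ k) / √ε := by
  have hσ := M.apmσ_pos k
  have hL := M.apmL_pos k hm hε
  rw [← Real.sqrt_div' _ hε.le, one_div, ← Real.sqrt_inv, apmq, inv_div]
  refine Real.sqrt_le_sqrt ?_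
  rw [div_right_comm]
  gcongr
  exact M.apmL_le_div k hm hε hε'

end Step

end FisherMarket

theorem theorem1 {n m : ℕ} (hm : 0 < m) (M : FisherMarket n m) (k : UtilityKind) :
    ∃ (C : ℝ) (d : ℕ), 0 < C ∧
      ∀ ε : ℝ, 0 < ε → ε ≤ Real.exp (M.muLower k - 1) →
        ∀ μ₀ : EuclideanSpace ℝ (Fin m),
          (∀ j, M.muLower k ≤ μ₀ j ∧ μ₀ j ≤ M.muUpper k) →
            ∃ T : ℕ, M.TerminatesAt k ε μ₀ T ∧
              M.IsApproxCE k ε (M.apmPrice k ε μ₀ T) ∧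
              (T : ℝ) ≤ C * (1 + |Real.log ε|) ^ d / √ε := by
  set A := 8 * (|Real.log (M.logConst k)| + 4) * √(M.smoothnessConst k / M.apmσ k) with hA
  have hA0 : 0 ≤ A := by positivity
  have hσ := M.apmσ_pos k
  refine ⟨A + √(M.apmσ k), 1, by positivity, fun ε hε hε' μ₀ hμ₀ => ?_⟩
  have hbox : μ₀ ∈ M.relaxedBox k := fun j =>
    ⟨by linarith [(hμ₀ j).1], by linarith [(hμ₀ j).2]⟩
  set R := 8 * (|Real.log (M.logConst k)| + 4 * |Real.log ε|) / √(M.apmq k ε) with hR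
  have hs0 := M.sqrt_apmq_pos k hm hε
  have hR0 : 0 ≤ R := by positivity
  have hst : M.Stops k ε (M.apmIter k ε μ₀ ⌈R⌉₊).1 :=
    M.stops_of_le k hm hε hε' hbox (Nat.le_ceil R)
  classical
  have hex : ∃ t, M.Stops k ε (M.apmIter k ε μ₀ t).1 := ⟨_, hst⟩
  have hmem : ∀ t, (M.apmIter k ε μ₀ t).1 ∈ M.relaxedBox k := by
    intro t
    cases t with
    | zero => exact hbox
    | succ t => exact M.gradStep_mem k hm hε _
  refine ⟨Nat.find hex, ⟨Nat.find_spec hex, fun t ht => Nat.find_min' hex ht⟩,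
    M.isApproxCE_of_stops k hm hε hε' (hmem _) (Nat.find_spec hex), ?_⟩
  have hT : (Nat.find hex : ℝ) ≤ R + 1 :=
    (Nat.cast_le.2 (Nat.find_min' hex hst)).trans (Nat.ceil_lt_add_one hR0).le
  have hlog := abs_nonneg (Real.log ε)
  have hsε : 0 < √ε := Real.sqrt_pos.2 hε
  have hRle : R ≤ A * (1 + |Real.log ε|) / √ε := by
    have h1 := M.inv_sqrt_apmq_le k hm hε hε'
    have h2 : |Real.log (M.logConst k)| + 4 * |Real.log ε| ≤
        (|Real.log (M.logConst k)| + 4) * (1 + |Real.log ε|) := by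
      nlinarith [mul_nonneg (abs_nonneg (Real.log (M.logConst k))) hlog]
    calc R = 8 * (|Real.log (M.logConst k)| + 4 * |Real.log ε|) * (1 / √(M.apmq k ε)) := by
          rw [hR]; ring
      _ ≤ 8 * ((|Real.log (M.logConst k)| + 4) * (1 + |Real.log ε|)) *
          (√(M.smoothnessConst k / M.apmσ k) / √ε) := by gcongr
      _ = _ := by rw [hA]; ring
  have hone : 1 ≤ √(M.apmσ k) * (1 + |Real.log ε|) / √ε := by
    rw [le_div_iff₀ hsε, one_mul]
    have : √ε ≤ √(M.apmσ k) := Real.sqrt_le_sqrt hε'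
    nlinarith [Real.sqrt_nonneg (M.apmσ k)]
  rw [pow_one, add_mul, add_div]
  linarith
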